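/- **Setting.** Let $N$ be even and $1\le p\le 2^{N/2}$. For a differentiable family $|\psi(\boldsymbol\theta)\rangle$ of pure states, $\boldsymbol\theta\in\mathbb R^M$, the quantum Fisher information metric (QFIM) is the real $M\times M$ matrix $$\mathcal F_{ij}(\boldsymbol\theta)=4\,\mathrm{Re}\big[\langle\partial_i\psi|\partial_j\psi\rangle-\langle\partial_i\psi|\psi\rangle\langle\psi|\partial_j\psi\rangle\big].$$ Write $R_\alpha^{(n)}(t)=\exp(-i\tfrac t2\sigma^\alpha_n)$, where $\sigma_n^\alpha$ is the Pauli matrix applied on qubit $n\in\{1,\dots,N\}$, and let $\mathrm{CPHASE}(n,m)$ be the controlled $\sigma^z$ gate on qubits $n,m$, with qubit indices taken modulo $N$ in $\{1,\dots,N\}$. *Shift factors.* Start with $A=\{0,1,\dots,N/2-1\}$ and $s=1$; in each iteration pick (in any order) and remove an element $r$ of $A$, set $a_s=r$ and $a_{s+q}=a_q$ for $1\le q\le s-1$, and replace $s$ by $2s$. When $A$ is exhausted this defines $a_1,\dots,a_{2^{N/2}-1}$. *Natural parameterized quantum circuit (NPQC).* Let $U(\boldsymbol\theta)=U_p\cdots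 U_2U_1$ with $$U_1=\prod_{n=1}^N R_z^{(n)}(\theta_{1,z}^{(n)})R_y^{(n)}(\theta_{1,y}^{(n)}),$$ $$U_l=\Big(\prod_{k=1}^{N/2}R_z^{(2k-1)}(\theta_{l,z}^{(2k-1)})R_y^{(2k-1)}(\theta_{l,y}^{(2k-1)})\Big)\,U_{\mathrm{ent}}(a_{l-1})\qquad(2\le l\le p),$$ $$U_{\mathrm{ent}}(a)=\prod_{k=1}^{N/2}\mathrm{CPHASE}(2k-1,2k+2a)\,R_y^{(2k-1)}(\pi/2).$$ Let $|0\rangle$ denote $|0\rangle^{\otimes N}$, let $\boldsymbol\theta_{\mathrm r}$ be the parameter with all $\theta_y=\pi/2$ and all $\theta_z=0$, and put $U_{\mathrm{fix}}=U(\boldsymbol\theta_{\mathrm r})$. **Claim.** The circuit has $M=N(p+1)$ parameters, $U(\boldsymbol\theta)$ is unitary for every $\boldsymbol\theta$, the state $U(\boldsymbol\theta)|0\rangle$ depends differentiably on $\boldsymbol\theta$, and for every order of picks: 1. The QFIM of $U(\boldsymbol\theta)|0\rangle$ at $\boldsymbol\theta_{\mathrm r}$ is exactly the identity, $\mathcal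 F(\boldsymbol\theta_{\mathrm r})=I_M$. 2. For every parameterized family $|\psi(\boldsymbol\theta)\rangle$ of $N$-qubit states, with any number of parameters, and every $N$-qubit unitary $V$ (independent of $\boldsymbol\theta$), the QFIM of $V|\psi(\boldsymbol\theta)\rangle$ equals that of $|\psi(\boldsymbol\theta)\rangle$ at every $\boldsymbol\theta$. 3. For every unitary $V_{\mathrm{ref}}$, the state $|\psi(\boldsymbol\theta)\rangle=V_{\mathrm{ref}}U_{\mathrm{fix}}^\dagger U(\boldsymbol\theta)|0\rangle$ depends differentiably on $\boldsymbol\theta$, satisfies $|\psi(\boldsymbol\theta_{\mathrm r})\rangle=V_{\mathrm{ref}}|0\rangle$, and has QFIM $\mathcal F(\boldsymbol\theta_{\mathrm r})=I_M$. Every unit vector $|\psi_{\mathrm r}\rangle$ of the $N$-qubit space is the reference state $|\psi(\boldsymbol\theta_{\mathrm r})\rangle$ for some unitary $V_{\mathrm{ref}}$. -/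

import Mathlib

noncomputable section

namespace NPQC

/-- The axes of the parameterized single-qubit rotations. -/
inductive Axis : Type
  | y : Axis
  | z : Axis
  deriving DecidableEq

instance : Fintype Axis where
  elems := {Axis.y, Axis.z}
  complete := by intro x; cases x <;> simp

/-- Labels of the computational basis of `N` qubits. Qubit number `n` (counted from 1) is the
coordinate `n - 1 : Fin N`. -/
abbrev Bits (N : ℕ) : Type := Fin N → Fin 2

/-- Operators on `N` qubits, as matrices in the computational basis. -/
abbrev Op (N : ℕ) : Type := Matrix (Bits N) (Bits N) ℂ

/-- The Hilbert space of `N` qubits. -/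
abbrev QState (N : ℕ) : Type := EuclideanSpace ℂ (Bits N)

/-- `|0⟩ = |0⟩^{⊗N}`. -/
def zeroState (N : ℕ) : QState N := EuclideanSpace.single (fun _ => 0) 1

/-- The action of an operator on a state. -/
def act {N : ℕ} (A : Op N) (v : QState N) : QState N := WithLp.toLp 2 (A.mulVec v.ofLp)

/-- The Pauli matrices `σ^y`, `σ^z`. -/
def pauli : Axis → Matrix (Fin 2) (Fin 2) ℂ
  | Axis.y => !![0, -Complex.I; Complex.I, 0]
  | Axis.z => !![1, 0; 0, -1]

/-- The one-qubit operator `A` applied on qubit `n` (and the identity on all the others). -/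
def onQubit {N : ℕ} (n : Fin N) (A : Matrix (Fin 2) (Fin 2) ℂ) : Op N :=
  Matrix.of fun b c => if ∀ m, m ≠ n → b m = c m then A (b n) (c n) else 0

/-- `R_α^{(n)}(t) = exp(-i (t/2) σ^α_n)`. -/
def rot {N : ℕ} (α : Axis) (n : Fin N) (t : ℝ) : Op N :=
  NormedSpace.exp ((-Complex.I * ((t : ℂ) / 2)) • onQubit n (pauli α))

/-- The controlled `σ^z` gate on the qubits `n`, `m`. -/
def cphase {N : ℕ} (n m : Fin N) : Op N :=
  Matrix.diagonal fun b => if b n = 1 ∧ b m = 1 then -1 else 1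

/-- For `k = 0, …, N/2 - 1`: the qubit number `2(k+1) - 1 = 2k + 1`, counted from 1. -/
def oddQubit {N : ℕ} (k : Fin (N / 2)) : Fin N := ⟨2 * k.1, by have := k.2; omega⟩

/-- For `k = 0, …, N/2 - 1`: the qubit number `2(k+1) + 2a` modulo `N`, counted from 1. -/
def shiftedQubit {N : ℕ} (k : Fin (N / 2)) (a : ℕ) : Fin N :=
  ⟨(2 * k.1 + 1 + 2 * a) % N, Nat.mod_lt _ (by have := k.2; omega)⟩

/-- `U_ent(a) = ∏_k CPHASE(2k-1, 2k+2a) R_y^{(2k-1)}(π/2)`. -/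
def entangler (N : ℕ) (a : ℕ) : Op N :=
  (List.ofFn fun k : Fin (N / 2) =>
    cphase (oddQubit k) (shiftedQubit k a) * rot Axis.y (oddQubit k) (Real.pi / 2)).prod

/-- One iteration of the recursive rule for the shift factors: from the current value of `s`, the
sequence `a` found so far (relevant at `1, …, s - 1`) and the picked element `r`, set `a_s = r`,
`a_{s+q} = a_q` for `q = 1, …, s - 1`, and then `s = 2 s`. -/
def shiftStep (st : ℕ × (ℕ → ℕ)) (r : ℕ) : ℕ × (ℕ → ℕ) :=
  (2 * st.1, fun l =>
    if l = st.1 then r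
    else if st.1 < l ∧ l < 2 * st.1 then st.2 (l - st.1)
    else st.2 l)

/-- The shift factors `a_1, a_2, …, a_{2^{N/2} - 1}`, when the elements of `{0, …, N/2 - 1}` are
picked and removed in the order `r 0, r 1, …`. (The value at other indices is irrelevant.) -/
def shiftFactor {N : ℕ} (r : Equiv.Perm (Fin (N / 2))) : ℕ → ℕ :=
  ((List.ofFn fun t => (r t).1).foldl shiftStep (1, fun _ => 0)).2

/-- Parameter labels: `inl (n, α)` stands for `θ_{1,α}^{(n)}`, any qubit `n`, and
`inr (j, k, α)` for the parameter of layer `l = j + 2 ∈ {2, …, p}` on the odd qubit number `k`. -/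
abbrev Param (N p : ℕ) : Type := (Fin N × Axis) ⊕ (Fin (p - 1) × Fin (N / 2) × Axis)

/-- The first layer. -/
def firstLayer {N p : ℕ} (θ : Param N p → ℝ) : Op N :=
  (List.ofFn fun n : Fin N =>
    rot Axis.z n (θ (Sum.inl (n, Axis.z))) * rot Axis.y n (θ (Sum.inl (n, Axis.y)))).prod

/-- Layer `l = j + 2`, with the `(l-1)`-st shift factor. -/
def furtherLayer {N p : ℕ} (r : Equiv.Perm (Fin (N / 2))) (θ : Param N p → ℝ)
    (j : Fin (p - 1)) : Op N :=
  (List.ofFn fun k : Fin (N / 2) =>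
    rot Axis.z (oddQubit k) (θ (Sum.inr (j, k, Axis.z))) *
      rot Axis.y (oddQubit k) (θ (Sum.inr (j, k, Axis.y)))).prod *
    entangler N (shiftFactor r (j.1 + 1))

/-- `U(θ) = U_p ⋯ U_2 U_1`: the first layer acts first. -/
def circuit {N p : ℕ} (r : Equiv.Perm (Fin (N / 2))) (θ : Param N p → ℝ) : Op N :=
  (List.ofFn fun j : Fin (p - 1) => furtherLayer r θ j).reverse.prod * firstLayer θ

/-- The NPQC state `U(θ)|0⟩`. -/
def npqcState {N p : ℕ} (r : Equiv.Perm (Fin (N / 2))) (θ : Param N p → ℝ) : QState N :=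
  act (circuit r θ) (zeroState N)

/-- The angle of the reference parameter for each axis. -/
def refAngle : Axis → ℝ
  | Axis.y => Real.pi / 2
  | Axis.z => 0

/-- The reference parameter `θ_r`: `θ_y = π/2` and `θ_z = 0` throughout. -/
def refParam (N p : ℕ) : Param N p → ℝ
  | Sum.inl (_, α) => refAngle α
  | Sum.inr (_, _, α) => refAngle α

/-- The NPQC with reference unitary `V`: the state `V U_fix† U(θ)|0⟩`, `U_fix = U(θ_r)`. -/
def npqcRefState {N p : ℕ} (r : Equiv.Perm (Fin (N / 2))) (V : Op N) (θ : Param N p → ℝ) :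
    QState N :=
  act (V * (circuit r (refParam N p)).conjTranspose * circuit r θ) (zeroState N)

/-- The partial derivative `∂_i |ψ⟩` at `θ`. -/
def partialState {ι E : Type*} [DecidableEq ι] [NormedAddCommGroup E] [InnerProductSpace ℂ E]
    (ψ : (ι → ℝ) → E) (θ : ι → ℝ) (i : ι) : E :=
  deriv (fun t : ℝ => ψ (Function.update θ i t)) (θ i)

/-- The quantum Fisher information metric of a family of pure states,
`F_ij(θ) = 4 Re [⟨∂_i ψ|∂_j ψ⟩ - ⟨∂_i ψ|ψ⟩⟨ψ|∂_j ψ⟩]`. -/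
def qfim {ι E : Type*} [DecidableEq ι] [NormedAddCommGroup E] [InnerProductSpace ℂ E]
    (ψ : (ι → ℝ) → E) (θ : ι → ℝ) : Matrix ι ι ℝ :=
  Matrix.of fun i j =>
    4 * (inner ℂ (partialState ψ θ i) (partialState ψ θ j) -
      inner ℂ (partialState ψ θ i) (ψ θ) * inner ℂ (ψ θ) (partialState ψ θ j)).re

end NPQC

end

noncomputable section

namespace NPQC

open Matrix

/-! Each parameter enters through one rotation `cos(t/2) - i sin(t/2) σ`, so a partial derivative of
the state is half the state with that angle increased by `π` (`partialState_npqcState`). The QFIM at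
the reference point is therefore a table of inner products of circuit states with at most one
shifted angle. All these states are, up to a phase, product states with every qubit in `|+⟩` or
`|-⟩`. Labelling `|0⟩, |+⟩, |1⟩, |-⟩` by `ZMod 4`, a quarter turn adds 1, and a CPHASE whose control
is `|0⟩` or `|1⟩` adds the control label to its target `|±⟩`. Hence labels evolve affinely
(`npqcState_mem_ray`). A shifted angle adds 2 at its site, and each later entangler copies this flip
from an odd qubit to one even qubit (`labelDiff_oddSite`). Different labels give orthogonal states.
Flips at different qubits are told apart by the qubit itself. Flips of one odd qubit in layers `l <
l'` differ by the copies made in between; these do not cancel because `a_l` is the pick number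
`v₂(l)`, and among consecutive integers the largest 2-adic valuation occurs only once
(`exists_isolated_padicValNat_two`). The `y` and `z` shifts at one site give the same label with
relative phase `±i`, whose real part vanishes. -/

/-! ### One-qubit operators and rotations. -/

theorem onQubit_mulVec {N : ℕ} (n : Fin N) (A : Matrix (Fin 2) (Fin 2) ℂ) (f : Bits N → ℂ)
    (b : Bits N) :
    (onQubit n A *ᵥ f) b = ∑ x, A (b n) x * f (Function.update b n x) := by
  classical
  have h : ∀ c : Bits N, (∀ m, m ≠ n → b m = c m) ↔ ∃ x, Function.update b n x = c := by
    intro c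
    constructor
    · intro h
      refine ⟨c n, funext fun m => ?_⟩
      by_cases hm : m = n
      · subst hm; simp
      · simp [hm, h m hm]
    · rintro ⟨x, rfl⟩ m hm
      simp [hm]
  have hinj : Function.Injective (fun x : Fin 2 => Function.update b n x) :=
    Function.update_injective b n
  have himg := Finset.sum_image (s := Finset.univ) (g := fun x : Fin 2 => Function.update b n x)
    (f := fun c => onQubit n A b c * f c) hinj.injOn
  trans ∑ c ∈ Finset.univ.image (fun x : Fin 2 => Function.update b n x), onQubit n A b c * f c
  · symm
    refine Finset.sum_subset (Finset.subset_univ _) fun c _ hc => ?_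
    have : ¬ ∀ m, m ≠ n → b m = c m := by
      rw [h]; simpa using hc
    simp only [onQubit, Matrix.of_apply]
    rw [if_neg this, zero_mul]
  · rw [himg]
    refine Finset.sum_congr rfl fun x _ => ?_
    have : ∀ m, m ≠ n → b m = Function.update b n x m := (h _).2 ⟨x, rfl⟩
    simp only [onQubit, Matrix.of_apply]
    rw [if_pos this]
    simp

theorem onQubit_mul {N : ℕ} (n : Fin N) (A B : Matrix (Fin 2) (Fin 2) ℂ) :
    onQubit n A * onQubit n B = onQubit n (A * B) := by
  refine Matrix.mulVec_injective (funext fun f => funext fun b => ?_)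
  rw [← Matrix.mulVec_mulVec]
  simp only [onQubit_mulVec, Matrix.mul_apply, Function.update_self, Function.update_idem,
    Finset.mul_sum, Finset.sum_mul]
  rw [Finset.sum_comm]
  simp only [mul_assoc]

theorem onQubit_one {N : ℕ} (n : Fin N) : onQubit n (1 : Matrix (Fin 2) (Fin 2) ℂ) = 1 := by
  refine Matrix.mulVec_injective (funext fun f => funext fun b => ?_)
  simp [onQubit_mulVec, Matrix.one_apply]

theorem onQubit_add {N : ℕ} (n : Fin N) (A B : Matrix (Fin 2) (Fin 2) ℂ) :
    onQubit n (A + B) = onQubit n A + onQubit n B := by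
  ext b c
  simp only [onQubit, Matrix.of_apply, Matrix.add_apply]
  split_ifs <;> simp

theorem onQubit_smul {N : ℕ} (n : Fin N) (z : ℂ) (A : Matrix (Fin 2) (Fin 2) ℂ) :
    onQubit n (z • A) = z • onQubit n A := by
  ext b c
  simp [onQubit]

theorem onQubit_conjTranspose {N : ℕ} (n : Fin N) (A : Matrix (Fin 2) (Fin 2) ℂ) :
    (onQubit n A)ᴴ = onQubit n Aᴴ := by
  ext b c
  simp only [onQubit, Matrix.of_apply, Matrix.conjTranspose_apply, eq_comm (a := b _)]
  split_ifs <;> simp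

theorem pauli_mul_self (α : Axis) : pauli α * pauli α = 1 := by
  cases α <;> ext i j <;> fin_cases i <;> fin_cases j <;> simp [pauli, Matrix.mul_apply]

section
attribute [local instance] Matrix.linftyOpNormedRing Matrix.linftyOpNormedAlgebra

/-- Even powers of `P` are 1 and odd powers are `P`, so the exponential series splits into those of
`cosh` and `sinh`. -/
theorem exp_smul_involution {m : Type*} [Fintype m] [DecidableEq m] (P : Matrix m m ℂ)
    (hP : P * P = 1) (z : ℂ) :
    NormedSpace.exp (z • P) = Complex.cosh z • (1 : Matrix m m ℂ) + Complex.sinh z • P := by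
  have heven : ∀ k, P ^ (2 * k) = 1 := fun k => by rw [pow_mul, pow_two, hP, one_pow]
  have h := NormedSpace.exp_series_hasSum_exp' (𝕂 := ℂ) (z • P)
  refine h.unique (HasSum.even_add_odd ?_ ?_)
  · have hc := (Complex.hasSum_cosh z).smul_const (1 : Matrix m m ℂ)
    simp only [smul_pow, heven, smul_smul]
    simp only [div_eq_inv_mul] at hc
    exact hc
  · have hs := (Complex.hasSum_sinh z).smul_const P
    simp only [smul_pow, pow_succ P, heven, one_mul, smul_smul]
    simp only [div_eq_inv_mul] at hs
    exact hs

end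

/-- The one-qubit rotation `cos(t/2) - i sin(t/2) σ^α`. -/
def rotMat (α : Axis) (t : ℝ) : Matrix (Fin 2) (Fin 2) ℂ :=
  (Real.cos (t / 2) : ℂ) • 1 + (-Complex.I * (Real.sin (t / 2) : ℂ)) • pauli α

theorem rot_eq_onQubit {N : ℕ} (α : Axis) (n : Fin N) (t : ℝ) :
    rot α n t = onQubit n (rotMat α t) := by
  have h : onQubit n (pauli α) * onQubit n (pauli α) = 1 := by
    rw [onQubit_mul, pauli_mul_self, onQubit_one]
  rw [rot, exp_smul_involution _ h, rotMat, onQubit_add, onQubit_smul, onQubit_smul, onQubit_one]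
  have e : -Complex.I * ((t : ℂ) / 2) = (-((t : ℂ) / 2)) * Complex.I := by ring
  rw [e, Complex.cosh_mul_I, Complex.sinh_mul_I, Complex.cos_neg, Complex.sin_neg]
  push_cast
  congr 2
  ring

theorem rotMat_y (t : ℝ) : rotMat Axis.y t =
    !![(Real.cos (t / 2) : ℂ), -(Real.sin (t / 2) : ℂ);
      (Real.sin (t / 2) : ℂ), (Real.cos (t / 2) : ℂ)] := by
  ext i j
  fin_cases i <;> fin_cases j <;> simp [rotMat, pauli]
  · linear_combination (Complex.sin (t / 2)) * Complex.I_mul_I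
  · linear_combination -(Complex.sin (t / 2)) * Complex.I_mul_I

theorem rotMat_mem_unitary (α : Axis) (t : ℝ) : (rotMat α t)ᴴ * rotMat α t = 1 := by
  have h1 : (pauli α)ᴴ = pauli α := by
    cases α <;> ext i j <;> fin_cases i <;> fin_cases j <;> simp [pauli]
  have h2 : ((Real.cos (t / 2) : ℂ)) ^ 2 + (Real.sin (t / 2) : ℂ) ^ 2 = 1 := by
    exact_mod_cast Real.cos_sq_add_sin_sq (t / 2)
  have h3 : (rotMat α t)ᴴ =
      (Real.cos (t / 2) : ℂ) • 1 + (Complex.I * (Real.sin (t / 2) : ℂ)) • pauli α := by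
    simp only [rotMat, conjTranspose_add, conjTranspose_smul, h1, conjTranspose_one, star_mul']
    simp only [Complex.star_def, Complex.conj_ofReal, map_neg, Complex.conj_I, neg_neg]
  rw [h3, rotMat]
  simp only [add_mul, mul_add, smul_mul_smul_comm, pauli_mul_self, one_mul, mul_one]
  have : ((Real.cos (t / 2) : ℂ) * (Real.cos (t / 2) : ℂ)) • (1 : Matrix (Fin 2) (Fin 2) ℂ)
      + (((Complex.I * (Real.sin (t / 2) : ℂ)) * (-Complex.I * (Real.sin (t / 2) : ℂ)))) •
        (1 : Matrix (Fin 2) (Fin 2) ℂ) = 1 := by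
    rw [← add_smul]
    convert one_smul ℂ (1 : Matrix (Fin 2) (Fin 2) ℂ) using 2
    linear_combination h2 - (Real.sin (t / 2) : ℂ) ^ 2 * Complex.I_mul_I
  have h4 : ((Complex.I * (Real.sin (t / 2) : ℂ)) * (Real.cos (t / 2) : ℂ)) • pauli α
    + ((Real.cos (t / 2) : ℂ) * (-Complex.I * (Real.sin (t / 2) : ℂ))) • pauli α = 0 := by
    rw [← add_smul]
    convert zero_smul ℂ (pauli α) using 2
    ring
  refine Eq.trans ?_ ((congrArg₂ (· + ·) this h4).trans (add_zero _))
  abel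

/-! ### Unitarity and differentiability of the circuit. -/

theorem rot_mem_unitaryGroup {N : ℕ} (α : Axis) (n : Fin N) (t : ℝ) :
    rot α n t ∈ unitaryGroup (Bits N) ℂ := by
  rw [mem_unitaryGroup_iff', rot_eq_onQubit, star_eq_conjTranspose, onQubit_conjTranspose,
    onQubit_mul, rotMat_mem_unitary, onQubit_one]

theorem cphase_mem_unitaryGroup {N : ℕ} (n m : Fin N) :
    cphase n m ∈ unitaryGroup (Bits N) ℂ := by
  rw [mem_unitaryGroup_iff', star_eq_conjTranspose, cphase, diagonal_conjTranspose,
    diagonal_mul_diagonal, ← diagonal_one]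
  congr 1
  ext b
  simp only [Pi.star_apply]
  split_ifs <;> simp

theorem prod_ofFn_mem {M : Type*} [Monoid M] (S : Submonoid M) {m : ℕ} {A : Fin m → M}
    (h : ∀ k, A k ∈ S) : (List.ofFn A).prod ∈ S := by
  refine S.list_prod_mem fun x hx => ?_
  obtain ⟨k, rfl⟩ := (List.mem_ofFn' _ _).1 hx
  exact h k

theorem prod_reverse_ofFn_mem {M : Type*} [Monoid M] (S : Submonoid M) {m : ℕ} {A : Fin m → M}
    (h : ∀ k, A k ∈ S) : (List.ofFn A).reverse.prod ∈ S := by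
  refine S.list_prod_mem fun x hx => ?_
  obtain ⟨k, rfl⟩ := (List.mem_ofFn' _ _).1 (List.mem_reverse.1 hx)
  exact h k

theorem circuit_mem_unitaryGroup {N p : ℕ} (r : Equiv.Perm (Fin (N / 2))) (θ : Param N p → ℝ) :
    circuit r θ ∈ unitaryGroup (Bits N) ℂ := by
  exact mul_mem (prod_reverse_ofFn_mem _ fun j => mul_mem
    (prod_ofFn_mem _ fun k => mul_mem (rot_mem_unitaryGroup _ _ _) (rot_mem_unitaryGroup _ _ _))
    (prod_ofFn_mem _ fun k => mul_mem (cphase_mem_unitaryGroup _ _) (rot_mem_unitaryGroup _ _ _)))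
    (prod_ofFn_mem _ fun n => mul_mem (rot_mem_unitaryGroup _ _ _) (rot_mem_unitaryGroup _ _ _))

/-- Operator families whose matrix entries depend differentiably on the parameter. -/
def differentiableOps (N : ℕ) (E : Type*) [NormedAddCommGroup E] [NormedSpace ℝ E] :
    Submonoid (E → Op N) where
  carrier := {A | ∀ b c, Differentiable ℝ fun θ => A θ b c}
  one_mem' := fun b c => by simp
  mul_mem' := fun {A B} hA hB b c => by
    simp only [Pi.mul_apply, Matrix.mul_apply]
    exact Differentiable.fun_sum fun x _ => (hA b x).mul (hB x c)

theorem rot_mem_differentiableOps {N : ℕ} {E : Type*} [NormedAddCommGroup E] [NormedSpace ℝ E]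
    (α : Axis) (n : Fin N) {f : E → ℝ} (hf : Differentiable ℝ f) :
    (fun θ => rot α n (f θ)) ∈ differentiableOps N E := by
  intro b c
  simp only [rot_eq_onQubit, rotMat, onQubit_add, onQubit_smul, Matrix.add_apply,
    Matrix.smul_apply, smul_eq_mul]
  have h (g : ℝ → ℝ) (hg : Differentiable ℝ g) :
      Differentiable ℝ fun θ => ((g (f θ / 2) : ℝ) : ℂ) :=
    Complex.ofRealCLM.differentiable.comp (hg.comp
      (by simpa only [div_eq_mul_inv] using hf.mul_const (2⁻¹ : ℝ)))
  have h1 := h _ Real.differentiable_cos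
  have h2 := h _ Real.differentiable_sin
  exact (h1.mul_const _).add ((h2.const_mul _).mul_const _)

theorem const_mem_differentiableOps {N : ℕ} {E : Type*} [NormedAddCommGroup E] [NormedSpace ℝ E]
    (A : Op N) : (fun _ => A) ∈ differentiableOps N E :=
  fun _ _ => differentiable_const _

theorem circuit_mem_differentiableOps {N p : ℕ} (r : Equiv.Perm (Fin (N / 2))) :
    circuit (N := N) (p := p) r ∈ differentiableOps N (Param N p → ℝ) := by
  have hprod {m : ℕ} (A : Fin m → (Param N p → ℝ) → Op N)
      (h : ∀ k, A k ∈ differentiableOps N (Param N p → ℝ)) :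
      (fun θ => (List.ofFn fun k => A k θ).prod) ∈ differentiableOps N (Param N p → ℝ) := by
    convert prod_ofFn_mem _ h using 1
    ext1 θ
    rw [Pi.list_prod_apply, List.map_ofFn]; rfl
  have hprod' {m : ℕ} (A : Fin m → (Param N p → ℝ) → Op N)
      (h : ∀ k, A k ∈ differentiableOps N (Param N p → ℝ)) :
      (fun θ => (List.ofFn fun k => A k θ).reverse.prod) ∈
        differentiableOps N (Param N p → ℝ) := by
    convert prod_reverse_ofFn_mem _ h using 1
    ext1 θ
    rw [Pi.list_prod_apply, List.map_reverse, List.map_ofFn]; rfl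
  have hrot (α : Axis) (n : Fin N) (i : Param N p) :
      (fun θ : Param N p → ℝ => rot α n (θ i)) ∈ differentiableOps N (Param N p → ℝ) :=
    rot_mem_differentiableOps α n (differentiable_apply i)
  exact mul_mem (hprod' (fun j θ => furtherLayer r θ j) fun j =>
    mul_mem (hprod _ fun k => mul_mem (hrot _ _ _) (hrot _ _ _)) (const_mem_differentiableOps _))
    (hprod _ fun n => mul_mem (hrot _ _ _) (hrot _ _ _))

/-! ### Product states labelled by `ZMod 4` and the action of the gates on them. -/

theorem act_mul {N : ℕ} (A B : Op N) (v : QState N) : act (A * B) v = act A (act B v) := by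
  simp [act, Matrix.mulVec_mulVec]

theorem act_one {N : ℕ} (v : QState N) : act 1 v = v := by
  simp [act]

theorem act_smul {N : ℕ} (A : Op N) (c : ℂ) (v : QState N) : act A (c • v) = c • act A v := by
  simp [act, Matrix.mulVec_smul]

/-- The one-qubit states `|0⟩`, `|+⟩`, `|1⟩`, `|-⟩`, in the cyclic order in which `R_y(π/2)`
permutes them up to a sign. -/
def ket : ZMod 4 → Fin 2 → ℂ :=
  (![![1, 0], ![(√2 / 2 : ℝ), (√2 / 2 : ℝ)], ![0, 1], ![(√2 / 2 : ℝ), -(√2 / 2 : ℝ)]] :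
    Fin 4 → Fin 2 → ℂ)

theorem ket_zero : ket 0 = ![1, 0] := rfl
theorem ket_one : ket 1 = ![((√2 / 2 : ℝ) : ℂ), ((√2 / 2 : ℝ) : ℂ)] := rfl
theorem ket_two : ket 2 = ![0, 1] := rfl
theorem ket_three : ket 3 = ![((√2 / 2 : ℝ) : ℂ), -((√2 / 2 : ℝ) : ℂ)] := rfl

/-- The product state of the qubits in the states `ket (q n)`. -/
def stab {N : ℕ} (q : Fin N → ZMod 4) : QState N :=
  WithLp.toLp 2 fun b => ∏ n, ket (q n) (b n)

/-- The multiples of `stab q` by the scalars `c` and `-c`. -/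
def ray {N : ℕ} (c : ℂ) (q : Fin N → ZMod 4) : Set (QState N) :=
  {v | v = c • stab q ∨ v = (-c) • stab q}

theorem act_onQubit_stab {N : ℕ} {n : Fin N} {A : Matrix (Fin 2) (Fin 2) ℂ}
    {q : Fin N → ZMod 4} {c : ℂ} {d : ZMod 4} (h : A *ᵥ ket (q n) = c • ket (q n + d)) :
    act (onQubit n A) (stab q) = c • stab (q + Pi.single n d) := by
  ext b
  have hsplit (f : Fin N → ℂ) : ∏ m, f m = f n * ∏ m ∈ Finset.univ.erase n, f m :=
    (Finset.mul_prod_erase _ _ (Finset.mem_univ n)).symm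
  have h1 : ∑ x, A (b n) x * ket (q n) x = c * ket (q n + d) (b n) := by
    simpa [Matrix.mulVec, dotProduct] using congrFun h (b n)
  simp only [act, stab, onQubit_mulVec, PiLp.smul_apply, smul_eq_mul]
  rw [hsplit]
  have h2 : ∀ m ∈ Finset.univ.erase n, ket ((q + Pi.single n d : Fin N → ZMod 4) m) (b m) =
      ket (q m) (b m) := by
    intro m hm
    simp [Finset.ne_of_mem_erase hm]
  rw [Finset.prod_congr rfl h2, ← mul_assoc]
  simp only [Pi.add_apply, Pi.single_eq_same]
  rw [← h1, Finset.sum_mul]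
  refine Finset.sum_congr rfl fun x _ => ?_
  rw [hsplit, mul_assoc, Function.update_self]
  congr 2
  refine Finset.prod_congr rfl fun m hm => ?_
  rw [Function.update_of_ne (Finset.ne_of_mem_erase hm)]

theorem act_onQubit_mem_ray {N : ℕ} {n : Fin N} {A : Matrix (Fin 2) (Fin 2) ℂ}
    {q : Fin N → ZMod 4} {c g : ℂ} {d : ZMod 4} {v : QState N}
    (h : A *ᵥ ket (q n) = g • ket (q n + d) ∨ A *ᵥ ket (q n) = (-g) • ket (q n + d))
    (hv : v ∈ ray c q) : act (onQubit n A) v ∈ ray (c * g) (q + Pi.single n d) := by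
  rcases h with h | h <;> rcases hv with rfl | rfl <;>
    simp only [ray, Set.mem_ofPred_eq, act_smul, act_onQubit_stab h, smul_smul] <;> simp

theorem forall_zmod_four {P : ZMod 4 → Prop} (h0 : P 0) (h1 : P 1) (h2 : P 2) (h3 : P 3)
    (x : ZMod 4) : P x := by
  fin_cases x
  exacts [h0, h1, h2, h3]

theorem sqrt_two_half_sq : ((√2 / 2 : ℝ) : ℂ) * ((√2 / 2 : ℝ) : ℂ) = 1 / 2 := by
  rw [← Complex.ofReal_mul]
  have : (√2 / 2) * (√2 / 2) = (1 / 2 : ℝ) := by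
    have := Real.mul_self_sqrt (show (0 : ℝ) ≤ 2 by norm_num)
    linarith
  rw [this]
  norm_num

theorem rotMat_y_pi_div_two : rotMat Axis.y (Real.pi / 2) =
    !![((√2 / 2 : ℝ) : ℂ), -((√2 / 2 : ℝ) : ℂ); ((√2 / 2 : ℝ) : ℂ), ((√2 / 2 : ℝ) : ℂ)] := by
  have h : Real.pi / 2 / 2 = Real.pi / 4 := by ring
  rw [rotMat_y, h, Real.cos_pi_div_four, Real.sin_pi_div_four]

theorem rotMat_y_three_pi_div_two : rotMat Axis.y (Real.pi / 2 + Real.pi) =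
    !![-((√2 / 2 : ℝ) : ℂ), -((√2 / 2 : ℝ) : ℂ); ((√2 / 2 : ℝ) : ℂ), -((√2 / 2 : ℝ) : ℂ)] := by
  have h : (Real.pi / 2 + Real.pi) / 2 = Real.pi / 4 + Real.pi / 2 := by ring
  rw [rotMat_y, h, Real.cos_add_pi_div_two, Real.sin_add_pi_div_two, Real.cos_pi_div_four,
    Real.sin_pi_div_four, Complex.ofReal_neg]

theorem rotMat_zero (α : Axis) : rotMat α 0 = 1 := by
  simp [rotMat]

theorem rotMat_z_pi : rotMat Axis.z Real.pi = !![-Complex.I, 0; 0, Complex.I] := by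
  ext i j
  fin_cases i <;> fin_cases j <;> simp [rotMat, pauli]

theorem rotMat_y_mulVec_ket (x : ZMod 4) :
    rotMat Axis.y (Real.pi / 2) *ᵥ ket x = (1 : ℂ) • ket (x + 1) ∨
      rotMat Axis.y (Real.pi / 2) *ᵥ ket x = (-1 : ℂ) • ket (x + 1) := by
  have h := sqrt_two_half_sq
  rw [rotMat_y_pi_div_two]
  revert x
  refine forall_zmod_four ?_ ?_ ?_ ?_
  · left
    rw [zero_add, ket_zero, ket_one]
    ext i; fin_cases i <;> simp
  · left
    rw [show (1 + 1 : ZMod 4) = 2 from rfl, ket_one, ket_two]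
    generalize ((√2 / 2 : ℝ) : ℂ) = s at h
    ext i; fin_cases i <;> simp [h]
    norm_num
  · right
    rw [show (2 + 1 : ZMod 4) = 3 from rfl, ket_two, ket_three]
    ext i; fin_cases i <;> simp
  · left
    rw [show (3 + 1 : ZMod 4) = 0 from rfl, ket_three, ket_zero]
    generalize ((√2 / 2 : ℝ) : ℂ) = s at h
    ext i; fin_cases i <;> simp [h]
    norm_num

/-- Parity in `ZMod 4` is expressed by doubling: `2 * x = 0` means `|0⟩` or `|1⟩`, and `2 * x = 2`
means `|±⟩`. -/
theorem eq_zero_or_two {x : ZMod 4} (h : 2 * x = 0) : x = 0 ∨ x = 2 := by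
  revert x; decide

theorem eq_one_or_three {x : ZMod 4} (h : 2 * x = 2) : x = 1 ∨ x = 3 := by
  revert x; decide

/-- The angles `(t_y, t_z)` of a pair of rotations are the reference angles, or exactly one of them
is increased by `π`; then the label of the resulting state is shifted by `d`, and its phase is
multiplied by `g`. -/
def FlipAngles (ty tz : ℝ) (d : ZMod 4) (g : ℂ) : Prop :=
  (ty = Real.pi / 2 ∧ tz = 0 ∧ d = 0 ∧ g = 1) ∨
  (ty = Real.pi / 2 + Real.pi ∧ tz = 0 ∧ d = 2 ∧ g = 1) ∨
  (ty = Real.pi / 2 ∧ tz = Real.pi ∧ d = 2 ∧ g = -Complex.I)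

/-- From `|0⟩` or `|1⟩` the reference `R_y` leads to `|±⟩`; an extra `R_y(π)` is two more quarter
turns, and `R_z(π) = -iσ^z` exchanges `|+⟩` and `|-⟩`. Both shift the label by 2 and differ only in
the phase. -/
theorem FlipAngles.mulVec_ket {ty tz : ℝ} {d : ZMod 4} {g : ℂ} (h : FlipAngles ty tz d g)
    {x : ZMod 4} (hx : 2 * x = 0) :
    (rotMat Axis.z tz * rotMat Axis.y ty) *ᵥ ket x = g • ket (x + (1 + d)) ∨
      (rotMat Axis.z tz * rotMat Axis.y ty) *ᵥ ket x = (-g) • ket (x + (1 + d)) := by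
  rcases h with ⟨rfl, rfl, rfl, rfl⟩ | ⟨rfl, rfl, rfl, rfl⟩ | ⟨rfl, rfl, rfl, rfl⟩
  · rw [rotMat_zero, one_mul, add_zero]
    exact rotMat_y_mulVec_ket x
  · right
    rw [rotMat_zero, one_mul, rotMat_y_three_pi_div_two]
    rcases eq_zero_or_two hx with rfl | rfl
    · rw [show (0 + (1 + 2) : ZMod 4) = 3 from rfl, ket_zero, ket_three]
      ext i; fin_cases i <;> simp
    · rw [show (2 + (1 + 2) : ZMod 4) = 1 from rfl, ket_two, ket_one]
      ext i; fin_cases i <;> simp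
  · rw [rotMat_z_pi, rotMat_y_pi_div_two]
    rcases eq_zero_or_two hx with rfl | rfl
    · left
      rw [show (0 + (1 + 2) : ZMod 4) = 3 from rfl, ket_zero, ket_three]
      ext i; fin_cases i <;> simp
    · right
      rw [show (2 + (1 + 2) : ZMod 4) = 1 from rfl, ket_two, ket_one]
      ext i; fin_cases i <;> simp

theorem act_rot_y_mem_ray {N : ℕ} (n : Fin N) {q : Fin N → ZMod 4} {c : ℂ} {v : QState N}
    (hv : v ∈ ray c q) :
    act (rot Axis.y n (Real.pi / 2)) v ∈ ray c (q + Pi.single n 1) := by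
  rw [rot_eq_onQubit]
  simpa using act_onQubit_mem_ray (rotMat_y_mulVec_ket (q n)) hv

theorem FlipAngles.act_mem_ray {N : ℕ} {n : Fin N} {ty tz : ℝ} {d : ZMod 4} {g : ℂ}
    (h : FlipAngles ty tz d g) {q : Fin N → ZMod 4} (hq : 2 * q n = 0) {c : ℂ} {v : QState N}
    (hv : v ∈ ray c q) :
    act (rot Axis.z n tz * rot Axis.y n ty) v ∈ ray (c * g) (q + Pi.single n (1 + d)) := by
  rw [rot_eq_onQubit, rot_eq_onQubit, onQubit_mul]
  exact act_onQubit_mem_ray (h.mulVec_ket hq) hv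

/-- With the control in `|0⟩` or `|1⟩` the gate is the identity or `σ^z` on the target, and `σ^z`
exchanges `|±⟩`, a label shift by 2, without any sign. -/
theorem act_cphase_stab {N : ℕ} {n m : Fin N} (hnm : n ≠ m) {q : Fin N → ZMod 4}
    (hn : 2 * q n = 0) (hm : 2 * q m = 2) :
    act (cphase n m) (stab q) = stab (q + Pi.single m (q n)) := by
  ext b
  simp only [act, stab, cphase, Matrix.mulVec_diagonal]
  rcases eq_zero_or_two hn with h | h
  · rw [h, Pi.single_zero, add_zero]
    by_cases hb : b n = 1
    · rw [Finset.prod_eq_zero (Finset.mem_univ n) (by rw [h, hb, ket_zero]; rfl), mul_zero]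
    · simp [hb]
  · by_cases hb : b n = 1
    · rw [← Finset.mul_prod_erase _ _ (Finset.mem_univ m),
        ← Finset.mul_prod_erase _ _ (Finset.mem_univ m), ← mul_assoc]
      congr 1
      · simp only [hb, true_and, Pi.add_apply, Pi.single_eq_same, h]
        generalize b m = x
        rcases eq_one_or_three hm with h' | h' <;> rw [h']
        · rw [show (1 + 2 : ZMod 4) = 3 from rfl, ket_one, ket_three]
          fin_cases x <;> simp
        · rw [show (3 + 2 : ZMod 4) = 1 from rfl, ket_one, ket_three]
          fin_cases x <;> simp
      · refine Finset.prod_congr rfl fun k hk => ?_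
        simp [Finset.ne_of_mem_erase hk]
    · have hb0 : b n = 0 := by omega
      rw [Finset.prod_eq_zero (Finset.mem_univ n) (by rw [h, hb0, ket_two]; rfl), mul_zero,
        Finset.prod_eq_zero (Finset.mem_univ n)]
      rw [Pi.add_apply, Pi.single_eq_of_ne hnm, add_zero, h, hb0, ket_two]
      rfl

theorem act_cphase_mem_ray {N : ℕ} {n m : Fin N} (hnm : n ≠ m) {q : Fin N → ZMod 4}
    (hn : 2 * q n = 0) (hm : 2 * q m = 2) {c : ℂ} {v : QState N} (hv : v ∈ ray c q) :
    act (cphase n m) v ∈ ray c (q + Pi.single m (q n)) := by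
  rcases hv with rfl | rfl
  · exact Or.inl (by rw [act_smul, act_cphase_stab hnm hn hm])
  · exact Or.inr (by rw [act_smul, act_cphase_stab hnm hn hm])

theorem apply_add_sum {α ι : Type*} [AddCommMonoid α] {P : α → Prop} {s : Finset ι} {w : ι → α}
    (hP : ∀ i ∈ s, ∀ q, P q → P (q + w i)) {q : α} (hq : P q) : P (q + ∑ i ∈ s, w i) := by
  classical
  induction s using Finset.induction_on generalizing q with
  | empty => simpa
  | insert i s hi ih =>
    rw [Finset.sum_insert hi, ← add_assoc]
    exact ih (fun j hj => hP j (Finset.mem_insert_of_mem hj))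
      (hP i (Finset.mem_insert_self _ _) _ hq)

/-- `P k` is the precondition under which the factor `A k` shifts labels by `w k`. The shifts of the
other factors preserve it, so shifts fixed in advance simply add up. -/
theorem act_prod_ofFn_mem_ray {N m : ℕ} {A : Fin m → Op N} {g : Fin m → ℂ}
    {w : Fin m → Fin N → ZMod 4} (P : Fin m → (Fin N → ZMod 4) → Prop)
    (hP : ∀ k k', k ≠ k' → ∀ q, P k q → P k (q + w k'))
    (hA : ∀ k q, P k q → ∀ c, ∀ v ∈ ray c q, act (A k) v ∈ ray (c * g k) (q + w k))
    {q : Fin N → ZMod 4} (hq : ∀ k, P k q) {c : ℂ} {v : QState N} (hv : v ∈ ray c q) :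
    act (List.ofFn A).prod v ∈ ray (c * ∏ k, g k) (q + ∑ k, w k) := by
  induction m with
  | zero => simpa [act_one] using hv
  | succ m ih =>
    rw [List.ofFn_succ, List.prod_cons, act_mul]
    have h := ih (fun k => P k.succ)
      (fun k k' h => hP k.succ k'.succ (by simpa using h)) (fun k => hA k.succ) (fun k => hq k.succ)
    have h0 : P 0 (q + ∑ k : Fin m, w k.succ) :=
      apply_add_sum (fun i _ => hP 0 i.succ (Fin.succ_ne_zero i).symm) (hq 0)
    have := hA 0 _ h0 _ _ h
    rwa [Fin.prod_univ_succ, Fin.sum_univ_succ, mul_comm (g 0), ← mul_assoc, add_comm (w 0),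
      ← add_assoc]

theorem act_prod_reverse_ofFn_mem_ray {N m : ℕ} {A : Fin m → Op N} {g : Fin m → ℂ}
    {Q : ℕ → Fin N → ZMod 4}
    (hA : ∀ k : Fin m, ∀ c, ∀ v ∈ ray c (Q k), act (A k) v ∈ ray (c * g k) (Q (k + 1)))
    {c : ℂ} {v : QState N} (hv : v ∈ ray c (Q 0)) :
    act (List.ofFn A).reverse.prod v ∈ ray (c * ∏ k, g k) (Q m) := by
  induction m generalizing Q c v with
  | zero => simpa [act_one] using hv
  | succ m ih =>
    rw [List.ofFn_succ, List.reverse_cons, List.prod_append, List.prod_singleton, act_mul,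
      Fin.prod_univ_succ, ← mul_assoc]
    exact ih (Q := fun k => Q (k + 1)) (fun k => by simpa using hA k.succ) (hA 0 _ _ hv)

theorem zeroState_mem_ray (N : ℕ) : zeroState N ∈ ray 1 (0 : Fin N → ZMod 4) := by
  left
  ext b
  simp only [zeroState, stab, one_smul, Pi.zero_apply, ket_zero, PiLp.single_apply]
  by_cases hb : b = fun _ => 0
  · subst hb; simp
  · rw [if_neg hb]
    obtain ⟨n, hn⟩ := Function.ne_iff.1 hb
    have hn1 : b n = 1 := by omega
    exact (Finset.prod_eq_zero (Finset.mem_univ n) (by simp [hn1])).symm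

theorem inner_ket (x y : ZMod 4) (hx : 2 * x = 2) (hy : 2 * y = 2) :
    ∑ i, star (ket x i) * ket y i = if x = y then 1 else 0 := by
  have h := sqrt_two_half_sq
  rcases eq_one_or_three hx with rfl | rfl <;> rcases eq_one_or_three hy with rfl | rfl
  · rw [if_pos rfl, ket_one]
    simp only [Fin.sum_univ_two, Matrix.cons_val_zero, Matrix.cons_val_one, Complex.star_def,
      Complex.conj_ofReal]
    linear_combination 2 * h
  · rw [if_neg (by decide), ket_one, ket_three]
    simp only [Fin.sum_univ_two, Matrix.cons_val_zero, Matrix.cons_val_one, Complex.star_def,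
      Complex.conj_ofReal]
    ring
  · rw [if_neg (by decide), ket_one, ket_three]
    simp only [Fin.sum_univ_two, Matrix.cons_val_zero, Matrix.cons_val_one, Complex.star_def,
      Complex.conj_ofReal, map_neg]
    ring
  · rw [if_pos rfl, ket_three]
    simp only [Fin.sum_univ_two, Matrix.cons_val_zero, Matrix.cons_val_one, Complex.star_def,
      Complex.conj_ofReal, map_neg]
    linear_combination 2 * h

/-- The inner product factors over the qubits, and `|+⟩, |-⟩` are orthonormal. -/
theorem inner_stab {N : ℕ} {q q' : Fin N → ZMod 4} (hq : ∀ n, 2 * q n = 2)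
    (hq' : ∀ n, 2 * q' n = 2) : inner ℂ (stab q) (stab q') = if q = q' then 1 else 0 := by
  have h : inner ℂ (stab q) (stab q') = ∏ n, ∑ i, star (ket (q n) i) * ket (q' n) i := by
    rw [Finset.prod_univ_sum, PiLp.inner_apply, Fintype.piFinset_univ]
    refine Finset.sum_congr rfl fun b _ => ?_
    simp only [stab, RCLike.inner_apply, map_prod, ← Finset.prod_mul_distrib]
    exact Finset.prod_congr rfl fun n _ => mul_comm _ _
  simp only [h, inner_ket _ _ (hq _) (hq' _), Finset.prod_ite_zero, Finset.prod_const_one,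
    funext_iff, Finset.mem_univ, true_imp_iff]

/-! ### Evolution of the labels through the layers. -/

theorem oddQubit_injective {N : ℕ} : Function.Injective (oddQubit (N := N)) := by
  intro k k' h
  have := congrArg Fin.val h
  simp only [oddQubit] at this
  exact Fin.ext (by omega)

/-- Reduction modulo an even `N` preserves parity, so no target of a CPHASE is ever a control. -/
theorem shiftedQubit_ne_oddQubit {N : ℕ} (hN : Even N) (k k' : Fin (N / 2)) (a : ℕ) :
    shiftedQubit k a ≠ oddQubit k' := by
  intro h
  have h1 := congrArg Fin.val h
  simp only [oddQubit, shiftedQubit] at h1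
  have h2 := Nat.mod_mod_of_dvd (2 * k.1 + 1 + 2 * a) hN.two_dvd
  omega

theorem shiftedQubit_injective {N : ℕ} (k : Fin (N / 2)) {a a' : ℕ} (ha : a < N / 2)
    (ha' : a' < N / 2) (h : shiftedQubit k a = shiftedQubit k a') : a = a' := by
  have h1 : (2 * k.1 + 1 + 2 * a) ≡ (2 * k.1 + 1 + 2 * a') [MOD N] := congrArg Fin.val h
  have h2 : 2 * a ≡ 2 * a' [MOD N] := Nat.ModEq.add_left_cancel' _ h1
  have h3 := Nat.ModEq.eq_of_lt_of_lt h2 (by omega) (by omega)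
  omega

theorem act_entangler_mem_ray {N : ℕ} (hN : Even N) (a : ℕ) {q : Fin N → ZMod 4}
    (hq : ∀ n, 2 * q n = 2) {c : ℂ} {v : QState N} (hv : v ∈ ray c q) :
    act (entangler N a) v ∈ ray c (q + ∑ k, (Pi.single (oddQubit k) 1 +
      Pi.single (shiftedQubit k a) (q (oddQubit k) + 1))) := by
  have h := act_prod_ofFn_mem_ray
    (A := fun k : Fin (N / 2) =>
      cphase (oddQubit k) (shiftedQubit k a) * rot Axis.y (oddQubit k) (Real.pi / 2))
    (g := fun _ => 1)
    (w := fun k => Pi.single (oddQubit k) 1 +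
      Pi.single (shiftedQubit k a) (q (oddQubit k) + 1))
    -- The control label is pinned to its initial value because the shift `w k` is written in terms
    -- of `q`; for the target only the parity matters, so several factors may hit the same qubit.
    (fun k q' => q' (oddQubit k) = q (oddQubit k) ∧ 2 * q' (shiftedQubit k a) = 2)
    ?_ ?_ (fun k => ⟨rfl, hq _⟩) hv
  · simpa [entangler] using h
  · rintro k k' hkk' q' ⟨h1, h2⟩
    have h3 : oddQubit k ≠ oddQubit k' := fun h => hkk' (oddQubit_injective h)
    have h4 := (shiftedQubit_ne_oddQubit hN k' k a).symm
    have h5 := shiftedQubit_ne_oddQubit hN k k' a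
    refine ⟨by simp [h1, h3, h4], ?_⟩
    have h6 : (2 : ZMod 4) * (q (oddQubit k') + 1) = 0 := by rw [mul_add, hq]; decide
    simp only [Pi.add_apply, mul_add, h2, Pi.single_eq_of_ne h5, zero_add]
    rw [Pi.single_apply]
    split_ifs
    · rw [h6, add_zero]
    · rw [mul_zero, add_zero]
  · rintro k q' ⟨h1, h2⟩ c v hv
    have h5 := shiftedQubit_ne_oddQubit hN k k a
    have h6 := act_cphase_mem_ray (n := oddQubit k) (m := shiftedQubit k a) h5.symm
      (by rw [Pi.add_apply, h1, Pi.single_eq_same, mul_add, hq]; decide)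
      (by rw [Pi.add_apply, Pi.single_eq_of_ne h5, add_zero, h2])
      (act_rot_y_mem_ray (oddQubit k) hv)
    rw [act_mul, mul_one]
    rwa [Pi.add_apply, Pi.single_eq_same, h1, add_assoc] at h6

/-- The labels of the qubits after the first `m + 1` layers, when the pair of rotations at the
site `s` shifts the label by `1 + d s`. The site `inl n` is the qubit `n` in the first layer, and
`inr (j, k)` is the odd qubit number `k` in the further layer number `j`. -/
def label {N : ℕ} (a : ℕ → ℕ) (d : Fin N ⊕ ℕ × Fin (N / 2) → ZMod 4) : ℕ → Fin N → ZMod 4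
  | 0 => fun n => 1 + d (Sum.inl n)
  | j + 1 => label a d j + ∑ k, (Pi.single (oddQubit k) 1 +
      Pi.single (shiftedQubit k (a (j + 1))) (label a d j (oddQubit k) + 1)) +
      ∑ k, Pi.single (oddQubit k) (1 + d (Sum.inr (j, k)))

theorem two_mul_single {N : ℕ} {x : ZMod 4} (hx : 2 * x = 0) (n m : Fin N) :
    2 * (Pi.single n x : Fin N → ZMod 4) m = 0 := by
  rw [Pi.single_apply]
  split_ifs
  exacts [hx, mul_zero _]

/-- A further layer gives each odd qubit two quarter turns, and every other shift is even; so after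
each full layer all qubits are again in `|±⟩`. -/
theorem two_mul_label {N : ℕ} (a : ℕ → ℕ) {d : Fin N ⊕ ℕ × Fin (N / 2) → ZMod 4}
    (hd : ∀ s, 2 * d s = 0) (m : ℕ) (n : Fin N) : 2 * label a d m n = 2 := by
  induction m generalizing n with
  | zero => simp [label, mul_add, hd]
  | succ j ih =>
    have h (k : Fin (N / 2)) : 2 * (Pi.single (shiftedQubit k (a (j + 1)))
        (label a d j (oddQubit k) + 1) : Fin N → ZMod 4) n = 0 :=
      two_mul_single (by rw [mul_add, ih]; decide) _ _
    have h' (k : Fin (N / 2)) : 2 * (Pi.single (oddQubit k) (1 + d (Sum.inr (j, k))) :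
        Fin N → ZMod 4) n = 2 * (Pi.single (oddQubit k) 1 : Fin N → ZMod 4) n := by
      rw [Pi.single_add, Pi.add_apply, mul_add, two_mul_single (hd _), add_zero]
    simp only [label, Pi.add_apply, Finset.sum_apply, mul_add, ih, Finset.mul_sum, h, h', add_zero]
    rw [add_assoc, ← Finset.sum_add_distrib, add_eq_left]
    refine Finset.sum_eq_zero fun k _ => ?_
    rw [← mul_add, Pi.single_apply]
    split_ifs <;> decide

theorem two_ne_zero_zmod_four : (2 : ZMod 4) ≠ 0 := by decide

theorem npqcState_mem_ray {N p : ℕ} (hN : Even N) (r : Equiv.Perm (Fin (N / 2)))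
    {θ : Param N p → ℝ} {d : Fin N ⊕ ℕ × Fin (N / 2) → ZMod 4}
    {g : Fin N ⊕ ℕ × Fin (N / 2) → ℂ} (hd : ∀ s, 2 * d s = 0)
    (h1 : ∀ n, FlipAngles (θ (Sum.inl (n, Axis.y))) (θ (Sum.inl (n, Axis.z)))
      (d (Sum.inl n)) (g (Sum.inl n)))
    (h2 : ∀ (j : Fin (p - 1)) k, FlipAngles (θ (Sum.inr (j, k, Axis.y)))
      (θ (Sum.inr (j, k, Axis.z))) (d (Sum.inr (j.1, k))) (g (Sum.inr (j.1, k)))) :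
    npqcState r θ ∈ ray ((∏ n, g (Sum.inl n)) * ∏ j : Fin (p - 1), ∏ k, g (Sum.inr (j.1, k)))
      (label (shiftFactor r) d (p - 1)) := by
  rw [npqcState, circuit, act_mul]
  refine act_prod_reverse_ofFn_mem_ray (fun j c v hv => ?_) ?_
  · rw [furtherLayer, act_mul]
    have h := act_entangler_mem_ray hN (shiftFactor r (j.1 + 1)) (two_mul_label _ hd _) hv
    refine act_prod_ofFn_mem_ray (w := fun k => Pi.single (oddQubit k) (1 + d (Sum.inr (j.1, k))))
      (fun k q => 2 * q (oddQubit k) = 0) ?_ ?_ ?_ h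
    · intro k k' hkk' q hq
      rw [Pi.add_apply, Pi.single_eq_of_ne (oddQubit_injective.ne hkk'), add_zero, hq]
    · exact fun k q hq c v hv => (h2 j k).act_mem_ray hq hv
    -- Between the entangler and the parameterized rotations an odd qubit has made just one quarter
    -- turn, so it is in `|0⟩` or `|1⟩`, as `FlipAngles.act_mem_ray` requires.
    · intro k
      simp only [Pi.add_apply, Finset.sum_apply, Finset.sum_add_distrib,
        Pi.single_eq_of_ne (shiftedQubit_ne_oddQubit hN _ _ _).symm, Finset.sum_const_zero,
        add_zero, mul_add, two_mul_label _ hd]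
      rw [Finset.sum_eq_single_of_mem k (Finset.mem_univ _), Pi.single_eq_same]
      · decide
      · exact fun k' _ h => Pi.single_eq_of_ne (oddQubit_injective.ne h.symm) _
  · have h := act_prod_ofFn_mem_ray
      (A := fun n => rot Axis.z n (θ (Sum.inl (n, Axis.z))) * rot Axis.y n (θ (Sum.inl (n, Axis.y))))
      (g := fun n => g (Sum.inl n)) (w := fun n => Pi.single n (1 + d (Sum.inl n)))
      (fun n q => 2 * q n = 0) ?_ ?_ (fun n => by simp) (zeroState_mem_ray N)
    · rw [one_mul, zero_add, Finset.univ_sum_single] at h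
      exact h
    · intro k k' hkk' q hq
      rw [Pi.add_apply, Pi.single_eq_of_ne hkk', add_zero, hq]
    · exact fun n q hq c v hv => (h1 n).act_mem_ray hq hv

/-! ### Propagation of a single flip, and why different flips stay distinguishable. -/

/-- The effect of the shifts `d` on the labels, relative to the reference labels. -/
def labelDiff {N : ℕ} (a : ℕ → ℕ) (d : Fin N ⊕ ℕ × Fin (N / 2) → ZMod 4) :
    ℕ → Fin N → ZMod 4
  | 0 => fun n => d (Sum.inl n)
  | j + 1 => labelDiff a d j +
      ∑ k, Pi.single (shiftedQubit k (a (j + 1))) (labelDiff a d j (oddQubit k)) +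
      ∑ k, Pi.single (oddQubit k) (d (Sum.inr (j, k)))

/-- The recursion for `label` is affine in `d`, with `labelDiff` as its linear part; comparing
labels reduces to comparing the latter. -/
theorem label_eq_add_labelDiff {N : ℕ} (a : ℕ → ℕ) (d : Fin N ⊕ ℕ × Fin (N / 2) → ZMod 4)
    (m : ℕ) : label a d m = label a 0 m + labelDiff a d m := by
  induction m with
  | zero => ext n; simp [label, labelDiff]
  | succ j ih =>
    simp only [label, labelDiff, ih, Pi.add_apply, Pi.single_add, Finset.sum_add_distrib,
      Pi.zero_apply, Pi.single_zero, Finset.sum_const_zero]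
    abel

/-- Such a qubit is never a control, so its flip is not copied. -/
theorem labelDiff_of_ne_oddQubit {N : ℕ} (a : ℕ → ℕ) {n : Fin N} (hn : ∀ k, n ≠ oddQubit k)
    (m : ℕ) : labelDiff a (Pi.single (Sum.inl n) 2) m = Pi.single n 2 := by
  induction m with
  | zero =>
    ext x
    by_cases h : x = n
    · subst h; simp [labelDiff]
    · simp [labelDiff, h]
  | succ j ih =>
    simp only [labelDiff, ih, Pi.single_eq_of_ne (hn _).symm, Pi.single_zero]
    simp

/-- The effect of a flip of the odd qubit number `k` in layer `l` after the layer `m`. -/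
def spread {N : ℕ} (a : ℕ → ℕ) (l : ℕ) (k : Fin (N / 2)) (m : ℕ) : Fin N → ZMod 4 :=
  Pi.single (oddQubit k) 2 + ∑ t ∈ Finset.Ico l m, Pi.single (shiftedQubit k (a (t + 1))) 2

/-- The copies land on even qubits only, so the odd qubits reveal where the flip was made. -/
theorem spread_oddQubit {N : ℕ} (hN : Even N) (a : ℕ → ℕ) (l : ℕ) (k : Fin (N / 2)) (m : ℕ)
    (k' : Fin (N / 2)) : spread a l k m (oddQubit k') = if k' = k then 2 else 0 := by
  simp only [spread, Pi.add_apply, Finset.sum_apply,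
    Pi.single_eq_of_ne (shiftedQubit_ne_oddQubit hN _ _ _).symm, Finset.sum_const_zero, add_zero,
    Pi.single_apply, oddQubit_injective.eq_iff]

theorem labelDiff_eq_spread_of_le {N : ℕ} (hN : Even N) (a : ℕ → ℕ)
    {d : Fin N ⊕ ℕ × Fin (N / 2) → ZMod 4} {l : ℕ} {k : Fin (N / 2)}
    (h0 : labelDiff a d l = Pi.single (oddQubit k) 2)
    (hd : ∀ j k, l ≤ j → d (Sum.inr (j, k)) = 0) {m : ℕ} (hm : l ≤ m) :
    labelDiff a d m = spread a l k m := by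
  induction m, hm using Nat.le_induction with
  | base => simp [h0, spread]
  | succ j hj ih =>
    simp only [labelDiff, ih, spread_oddQubit hN, hd _ _ hj, Pi.single_zero,
      Finset.sum_const_zero, add_zero]
    rw [Finset.sum_eq_single_of_mem k (Finset.mem_univ _), if_pos rfl]
    · rw [spread, spread, Finset.sum_Ico_succ_top hj, add_assoc]
    · intro k' _ h
      rw [if_neg h, Pi.single_zero]

/-- The site of the odd qubit number `k` in layer `l`. -/
def oddSite {N : ℕ} (k : Fin (N / 2)) : ℕ → Fin N ⊕ ℕ × Fin (N / 2)
  | 0 => Sum.inl (oddQubit k)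
  | j + 1 => Sum.inr (j, k)

theorem labelDiff_eq_zero {N : ℕ} (a : ℕ → ℕ) (d : Fin N ⊕ ℕ × Fin (N / 2) → ZMod 4) (m : ℕ)
    (h : ∀ n, d (Sum.inl n) = 0) (h' : ∀ j k, j < m → d (Sum.inr (j, k)) = 0) :
    labelDiff a d m = 0 := by
  induction m with
  | zero => ext n; simp [labelDiff, h]
  | succ j ih =>
    simp [labelDiff, ih fun i k hi => h' i k (hi.trans j.lt_succ_self), h' j _ j.lt_succ_self]

theorem labelDiff_oddSite {N : ℕ} (hN : Even N) (a : ℕ → ℕ) {l : ℕ} (k : Fin (N / 2)) {m : ℕ}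
    (hm : l ≤ m) : labelDiff a (Pi.single (oddSite k l) 2) m = spread a l k m := by
  refine labelDiff_eq_spread_of_le hN a ?_ ?_ hm
  · cases l with
    | zero =>
      ext x
      by_cases h : x = oddQubit k
      · subst h; simp [labelDiff, oddSite]
      · simp [labelDiff, oddSite, h]
    | succ j =>
      rw [labelDiff, labelDiff_eq_zero]
      · simp only [Pi.zero_apply, Pi.single_zero, Finset.sum_const_zero, zero_add, oddSite]
        rw [Finset.sum_eq_single_of_mem k (Finset.mem_univ _), Pi.single_eq_same]
        intro k' _ h
        rw [Pi.single_eq_of_ne (by simpa using h), Pi.single_zero]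
      · simp [oddSite]
      · intro i k' hi
        rw [Pi.single_eq_of_ne]
        simp [oddSite, hi.ne]
  · intro j k' hj
    rw [Pi.single_eq_of_ne]
    cases l with
    | zero => simp [oddSite]
    | succ i => simp only [oddSite, ne_eq, Sum.inr.injEq, Prod.mk.injEq]; omega

/-- Every block of consecutive shift factors contains one that occurs only once in it. -/
def HasIsolatedShifts (N : ℕ) (a : ℕ → ℕ) (m : ℕ) : Prop :=
  ∀ l l', l < l' → l' ≤ m → ∃ t₀ ∈ Finset.Ico l l', ∀ t ∈ Finset.Ico l l', t ≠ t₀ →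
    ∀ k : Fin (N / 2), shiftedQubit k (a t₀.succ) ≠ shiftedQubit k (a t.succ)

/-- The copies made from layer `l'` on are common to both sides and cancel. Among the remaining
ones, the isolated shift hits its target exactly once, leaving a 2 there. -/
theorem spread_ne_of_lt {N : ℕ} {a : ℕ → ℕ} {m : ℕ} (ha : HasIsolatedShifts N a m)
    (k : Fin (N / 2)) {l l' : ℕ} (hl : l < l') (hm : l' ≤ m) :
    spread a l k m ≠ spread a l' k m := by
  intro h
  obtain ⟨t₀, ht₀, hu⟩ := ha l l' hl hm
  rw [spread, spread, ← Finset.sum_Ico_consecutive _ hl.le hm, add_right_inj, add_eq_right] at h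
  have h1 := congrFun h (shiftedQubit k (a t₀.succ))
  rw [Finset.sum_apply, Finset.sum_eq_single_of_mem t₀ ht₀, Pi.single_eq_same] at h1
  · exact two_ne_zero_zmod_four h1
  · exact fun t ht hne => Pi.single_eq_of_ne (hu t ht hne k) _

theorem exists_site {N : ℕ} (hN : Even N) (a : ℕ → ℕ) {m : ℕ} (s : Fin N ⊕ ℕ × Fin (N / 2))
    (hs : ∀ j k, s = Sum.inr (j, k) → j < m) :
    (∃ n, (∀ k, n ≠ oddQubit k) ∧ s = Sum.inl n ∧
      labelDiff a (Pi.single s 2) m = Pi.single n 2) ∨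
    ∃ l k, l ≤ m ∧ s = oddSite k l ∧ labelDiff a (Pi.single s 2) m = spread a l k m := by
  rcases s with n | ⟨j, k⟩
  · by_cases h : ∃ k, n = oddQubit k
    · obtain ⟨k, rfl⟩ := h
      exact Or.inr ⟨0, k, m.zero_le, rfl, labelDiff_oddSite hN a (l := 0) k m.zero_le⟩
    · push Not at h
      exact Or.inl ⟨n, h, rfl, labelDiff_of_ne_oddQubit a h m⟩
  · exact Or.inr ⟨j + 1, k, hs j k rfl, rfl, labelDiff_oddSite hN a (l := j + 1) k (hs j k rfl)⟩

theorem labelDiff_single_ne_zero {N : ℕ} (hN : Even N) (a : ℕ → ℕ) {m : ℕ}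
    (s : Fin N ⊕ ℕ × Fin (N / 2)) (hs : ∀ j k, s = Sum.inr (j, k) → j < m) :
    labelDiff a (Pi.single s 2) m ≠ 0 := by
  rcases exists_site hN a s hs with ⟨n, -, -, h⟩ | ⟨l, k, -, -, h⟩ <;> rw [h] <;> intro h0
  · have := congrFun h0 n
    rw [Pi.single_eq_same] at this
    exact two_ne_zero_zmod_four this
  · have := congrFun h0 (oddQubit k)
    rw [spread_oddQubit hN, if_pos rfl] at this
    exact two_ne_zero_zmod_four this

theorem labelDiff_single_injective {N : ℕ} (hN : Even N) {a : ℕ → ℕ} {m : ℕ}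
    (ha : HasIsolatedShifts N a m) {s s' : Fin N ⊕ ℕ × Fin (N / 2)}
    (hs : ∀ j k, s = Sum.inr (j, k) → j < m) (hs' : ∀ j k, s' = Sum.inr (j, k) → j < m)
    (h : labelDiff a (Pi.single s 2) m = labelDiff a (Pi.single s' 2) m) : s = s' := by
  have key (n : Fin N) (hn : ∀ k, n ≠ oddQubit k) (l : ℕ) (k : Fin (N / 2)) :
      spread a l k m ≠ Pi.single n 2 := by
    intro h
    have := congrFun h (oddQubit k)
    rw [spread_oddQubit hN, if_pos rfl, Pi.single_eq_of_ne (hn k).symm] at this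
    exact two_ne_zero_zmod_four this
  rcases exists_site hN a s hs with ⟨n, hn, hs1, h1⟩ | ⟨l, k, hl, hs1, h1⟩ <;>
    rcases exists_site hN a s' hs' with ⟨n', hn', hs2, h2⟩ | ⟨l', k', hl', hs2, h2⟩ <;>
    rw [h1, h2] at h
  · have := congrFun h n
    rw [Pi.single_eq_same, Pi.single_apply] at this
    split_ifs at this with hnn
    · rw [hs1, hs2, hnn]
    · exact absurd this two_ne_zero_zmod_four
  · exact absurd h.symm (key n hn l' k')
  · exact absurd h (key n' hn' l k)
  · have hk := congrFun h (oddQubit k)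
    rw [spread_oddQubit hN, spread_oddQubit hN, if_pos rfl] at hk
    split_ifs at hk with hkk
    · subst hkk
      rcases lt_trichotomy l l' with hll | rfl | hll
      · exact absurd h (spread_ne_of_lt ha k hll hl')
      · rw [hs1, hs2]
      · exact absurd h.symm (spread_ne_of_lt ha k hll hl)
    · exact absurd hk two_ne_zero_zmod_four

/-! ### Shift factors and 2-adic valuations. -/

theorem padicValNat_two_eq {x v : ℕ} (h : 2 ^ v ∣ x) (h' : ¬ 2 ^ (v + 1) ∣ x) :
    padicValNat 2 x = v := by
  have hx : x ≠ 0 := by rintro rfl; exact h' (dvd_zero _)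
  have h1 := (padicValNat_dvd_iff_le (p := 2) hx).1 h
  have h2 := mt (padicValNat_dvd_iff_le (p := 2) hx).2 h'
  omega

/-- The recursive doubling rule mirrors `v₂(2^s + q) = v₂(q)` for `0 < q < 2^s`, together with
`v₂(2^s) = s`: the factor with index `l` is the pick number `v₂(l)`, counted from 0. -/
theorem foldl_shiftStep (L : List ℕ) :
    (L.foldl shiftStep (1, fun _ => 0)).1 = 2 ^ L.length ∧
    ∀ l, 1 ≤ l → l < 2 ^ L.length →
      L[padicValNat 2 l]? = some ((L.foldl shiftStep (1, fun _ => 0)).2 l) := by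
  induction L using List.reverseRecOn with
  | nil => exact ⟨rfl, fun l h1 h2 => by simp at h2; omega⟩
  | append_singleton L x ih =>
    obtain ⟨ih1, ih2⟩ := ih
    rw [List.foldl_append]
    generalize L.foldl shiftStep (1, fun _ => 0) = st at *
    simp only [List.foldl_cons, List.foldl_nil, shiftStep, ih1, List.length_append,
      List.length_singleton]
    refine ⟨by rw [pow_succ, mul_comm], fun l h1 h2 => ?_⟩
    have hsome {i : ℕ} {y : ℕ} (h : L[i]? = some y) : (L ++ [x])[i]? = some y := by
      rw [List.getElem?_append_left (List.getElem?_eq_some_iff.1 h).1, h]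
    rcases lt_trichotomy l (2 ^ L.length) with hl | rfl | hl
    · rw [if_neg hl.ne, if_neg (by omega)]
      exact hsome (ih2 l h1 hl)
    · simp
    · rw [if_neg hl.ne', if_pos ⟨hl, by rwa [mul_comm, ← pow_succ]⟩]
      obtain ⟨q, rfl⟩ := Nat.exists_eq_add_of_lt hl
      have hq : q + 1 < 2 ^ L.length := by rw [pow_succ] at h2; omega
      have hv := ih2 (q + 1) (by omega) hq
      have e : 2 ^ L.length + q + 1 - 2 ^ L.length = q + 1 := by omega
      rw [e]
      refine hsome (Eq.trans (congrArg (fun i => L[i]?) ?_) hv)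
      have hlt := (List.getElem?_eq_some_iff.1 hv).1
      -- The valuation of `q + 1` is below `L.length`, so adding `2 ^ L.length` does not change it.
      have hd : 2 ^ (padicValNat 2 (q + 1) + 1) ∣ 2 ^ L.length := pow_dvd_pow 2 hlt
      refine padicValNat_two_eq ?_ ?_
      · rw [add_assoc]
        exact dvd_add ((pow_dvd_pow 2 hlt.le)) pow_padicValNat_dvd
      · rw [add_assoc, Nat.dvd_add_right hd]
        exact pow_succ_padicValNat_not_dvd (by omega)

theorem shiftFactor_eq {N : ℕ} (r : Equiv.Perm (Fin (N / 2))) {l : ℕ} (h1 : 1 ≤ l)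
    (h2 : l < 2 ^ (N / 2)) :
    ∃ h : padicValNat 2 l < N / 2, shiftFactor r l = (r ⟨padicValNat 2 l, h⟩).1 := by
  have h := (foldl_shiftStep (List.ofFn fun t => (r t).1)).2 l h1 (by simpa using h2)
  obtain ⟨hlt, h⟩ := List.getElem?_eq_some_iff.1 h
  refine ⟨by simpa using hlt, ?_⟩
  rw [shiftFactor, ← h, List.getElem_ofFn]

theorem exists_isolated_padicValNat_two {l l' : ℕ} (h : l < l') :
    ∃ t₀ ∈ Finset.Ico l l', ∀ t ∈ Finset.Ico l l', t ≠ t₀ →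
      padicValNat 2 (t₀ + 1) ≠ padicValNat 2 (t + 1) := by
  obtain ⟨t₀, ht₀, hmax⟩ := Finset.exists_max_image (Finset.Ico l l')
    (fun t => padicValNat 2 (t + 1)) ⟨l, Finset.mem_Ico.2 ⟨le_rfl, h⟩⟩
  have key : ∀ x ∈ Finset.Ico l l', ∀ y ∈ Finset.Ico l l', x < y →
      padicValNat 2 (t₀ + 1) = padicValNat 2 (x + 1) →
      padicValNat 2 (t₀ + 1) = padicValNat 2 (y + 1) → False := by
    intro x hx y hy hxy h1 h2
    set v := padicValNat 2 (t₀ + 1)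
    obtain ⟨u, hu⟩ : 2 ^ v ∣ x + 1 := h1 ▸ pow_padicValNat_dvd
    obtain ⟨w, hw⟩ : 2 ^ v ∣ y + 1 := h2 ▸ pow_padicValNat_dvd
    have hu2 : ¬ 2 ^ (v + 1) ∣ x + 1 := h1 ▸ pow_succ_padicValNat_not_dvd (by omega)
    have hodd : ¬ 2 ∣ u := fun hdvd => hu2 (by rw [hu, pow_succ]; exact mul_dvd_mul_left _ hdvd)
    have hw2 : ¬ 2 ^ (v + 1) ∣ y + 1 := h2 ▸ pow_succ_padicValNat_not_dvd (by omega)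
    have hodd' : ¬ 2 ∣ w := fun hdvd => hw2 (by rw [hw, pow_succ]; exact mul_dvd_mul_left _ hdvd)
    have huw : u < w := by
      refine lt_of_mul_lt_mul_left (a := 2 ^ v) ?_ (Nat.zero_le _)
      omega
    have hz : 2 ^ v * (u + 1) ≤ 2 ^ v * w := Nat.mul_le_mul_left _ huw
    have hpos : 0 < 2 ^ v := by positivity
    have hzx : 2 ^ v * (u + 1) = x + 1 + 2 ^ v := by rw [mul_add, hu, mul_one]
    rw [Finset.mem_Ico] at hx hy
    -- If `x + 1 < y + 1` both have the maximal valuation `v`, then `x + 1` is an odd multiple of `2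
    -- ^ v`; the next multiple is an even one, at most `y + 1`, and has larger valuation.
    have h3 := hmax (x + 2 ^ v) (Finset.mem_Ico.2 ⟨by omega, by omega⟩)
    have h4 : 2 ^ (v + 1) ∣ x + 2 ^ v + 1 := by
      rw [show x + 2 ^ v + 1 = 2 ^ v * (u + 1) by omega, pow_succ]
      exact mul_dvd_mul_left _ (by omega)
    have h5 := (padicValNat_dvd_iff_le (p := 2) (by omega)).1 h4
    change _ ≤ v at h3
    omega
  refine ⟨t₀, ht₀, fun t ht hne heq => ?_⟩
  rcases lt_or_gt_of_ne hne with hlt | hlt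
  · exact key t ht t₀ ht₀ hlt heq rfl
  · exact key t₀ ht₀ t ht hlt rfl heq

theorem hasIsolatedShifts_shiftFactor {N : ℕ} (r : Equiv.Perm (Fin (N / 2))) {m : ℕ}
    (hm : m < 2 ^ (N / 2)) : HasIsolatedShifts N (shiftFactor r) m := by
  intro l l' hl hl'
  obtain ⟨t₀, ht₀, h⟩ := exists_isolated_padicValNat_two hl
  refine ⟨t₀, ht₀, fun t ht hne k heq => h t ht hne ?_⟩
  rw [Finset.mem_Ico] at ht ht₀
  obtain ⟨h1, e1⟩ := shiftFactor_eq r (l := t₀.succ) (by omega) (by omega)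
  obtain ⟨h2, e2⟩ := shiftFactor_eq r (l := t.succ) (by omega) (by omega)
  rw [e1, e2] at heq
  have h3 := shiftedQubit_injective k (r _).2 (r _).2 heq
  exact congrArg Fin.val (r.injective (Fin.ext h3))

/-! ### Partial derivatives and unitary invariance of the QFIM. -/

theorem exists_prod_ofFn_eq_mul_mul {M ι : Type*} [Monoid M] {m : ℕ} (A : Fin m → ι → M)
    (k₀ : Fin m) (hA : ∀ k, k ≠ k₀ → ∀ s t, A k s = A k t) :
    ∃ L R, ∀ t, (List.ofFn fun k => A k t).prod = L * A k₀ t * R := by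
  induction m with
  | zero => exact k₀.elim0
  | succ m ih =>
    rcases isEmpty_or_nonempty ι with hι | ⟨⟨t₀⟩⟩
    · exact ⟨1, 1, fun t => isEmptyElim t⟩
    simp only [List.ofFn_succ, List.prod_cons]
    induction k₀ using Fin.cases with
    | zero =>
      refine ⟨1, (List.ofFn fun k : Fin m => A k.succ t₀).prod, fun t => ?_⟩
      rw [one_mul]
      congr 3
      ext k
      exact hA _ (Fin.succ_ne_zero k) _ _
    | succ k₀ =>
      obtain ⟨L, R, h⟩ := ih (fun k => A k.succ) k₀
        (fun k hk => hA k.succ (by simpa using hk))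
      exact ⟨A 0 t₀ * L, R, fun t => by
        rw [h, hA 0 (Fin.succ_ne_zero k₀).symm t t₀]; simp only [mul_assoc]⟩

theorem exists_prod_reverse_ofFn_eq_mul_mul {M ι : Type*} [Monoid M] {m : ℕ}
    (A : Fin m → ι → M) (k₀ : Fin m) (hA : ∀ k, k ≠ k₀ → ∀ s t, A k s = A k t) :
    ∃ L R, ∀ t, (List.ofFn fun k => A k t).reverse.prod = L * A k₀ t * R := by
  -- A reversed product is an ordinary product in the opposite monoid, which also exchanges `L` and
  -- `R`.
  obtain ⟨L, R, h⟩ := exists_prod_ofFn_eq_mul_mul (fun k t => MulOpposite.op (A k t)) k₀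
    (fun k hk s t => congrArg _ (hA k hk s t))
  refine ⟨R.unop, L.unop, fun t => ?_⟩
  have h1 := congrArg MulOpposite.unop (h t)
  rw [MulOpposite.unop_list_prod, List.map_ofFn] at h1
  simpa [Function.comp_def, mul_assoc] using h1

theorem exists_circuit_update_eq {N p : ℕ} (r : Equiv.Perm (Fin (N / 2))) (θ : Param N p → ℝ)
    (i : Param N p) :
    ∃ L R α n, ∀ t, circuit r (Function.update θ i t) = L * rot α n t * R := by
  have hpair (n : Fin N) (y z : Param N p) (hyz : y ≠ z) (hi : i = y ∨ i = z) :
      ∃ L R α, ∀ t, rot Axis.z n (Function.update θ i t z) *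
        rot Axis.y n (Function.update θ i t y) = L * rot α n t * R := by
    rcases hi with rfl | rfl
    · exact ⟨rot Axis.z n (θ z), 1, Axis.y, fun t => by simp [hyz.symm]⟩
    · exact ⟨1, rot Axis.y n (θ y), Axis.z, fun t => by simp [hyz]⟩
  rcases i with ⟨n, α⟩ | ⟨j, k, α⟩
  · obtain ⟨L₁, R₁, α', h₁⟩ := hpair n (Sum.inl (n, Axis.y)) (Sum.inl (n, Axis.z)) (by simp)
      (by cases α <;> simp)
    obtain ⟨L₂, R₂, h₂⟩ := exists_prod_ofFn_eq_mul_mul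
      (fun n' t => rot Axis.z n' (Function.update θ (Sum.inl (n, α)) t (Sum.inl (n', Axis.z))) *
        rot Axis.y n' (Function.update θ (Sum.inl (n, α)) t (Sum.inl (n', Axis.y)))) n
      (fun n' h s t => by simp [h])
    refine ⟨(List.ofFn fun j => furtherLayer r θ j).reverse.prod * L₂ * L₁, R₁ * R₂, α', n,
      fun t => ?_⟩
    have h₃ (j : Fin (p - 1)) :
        furtherLayer r (Function.update θ (Sum.inl (n, α)) t) j = furtherLayer r θ j := by
      simp [furtherLayer]
    rw [circuit, firstLayer, h₂, h₁]
    simp only [h₃, mul_assoc]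
  · obtain ⟨L₁, R₁, α', h₁⟩ := hpair (oddQubit k) (Sum.inr (j, k, Axis.y))
      (Sum.inr (j, k, Axis.z)) (by simp) (by cases α <;> simp)
    obtain ⟨L₂, R₂, h₂⟩ := exists_prod_ofFn_eq_mul_mul
      (fun k' t => rot Axis.z (oddQubit k')
          (Function.update θ (Sum.inr (j, k, α)) t (Sum.inr (j, k', Axis.z))) *
        rot Axis.y (oddQubit k')
          (Function.update θ (Sum.inr (j, k, α)) t (Sum.inr (j, k', Axis.y)))) k
      (fun k' h s t => by simp [h])
    obtain ⟨L₃, R₃, h₃⟩ := exists_prod_reverse_ofFn_eq_mul_mul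
      (fun j' t => furtherLayer r (Function.update θ (Sum.inr (j, k, α)) t) j') j
      (fun j' h s t => by simp [furtherLayer, h])
    refine ⟨L₃ * L₂ * L₁, R₁ * R₂ * entangler N (shiftFactor r (j.1 + 1)) * R₃ * firstLayer θ, α',
      oddQubit k, fun t => ?_⟩
    have h₄ : firstLayer (Function.update θ (Sum.inr (j, k, α)) t) = firstLayer θ := by
      simp [firstLayer]
    rw [circuit, h₃, h₄, furtherLayer, h₂, h₁]
    simp only [mul_assoc]

/-- The action of an operator on states, as a continuous linear map. -/
def actCLM {N : ℕ} (A : Op N) : QState N →L[ℂ] QState N := Matrix.toEuclideanCLM (𝕜 := ℂ) A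

theorem inner_act_act {N : ℕ} {V : Op N} (hV : V ∈ unitaryGroup (Bits N) ℂ) (v w : QState N) :
    inner ℂ (act V v) (act V w) = inner ℂ v w := by
  have h : Vᴴ * V = 1 := mem_unitaryGroup_iff'.1 hV
  simp only [act, EuclideanSpace.inner_eq_star_dotProduct]
  rw [star_mulVec, dotProduct_comm, ← dotProduct_mulVec, mulVec_mulVec, h, one_mulVec,
    dotProduct_comm]

theorem deriv_act {N : ℕ} {V : Op N} (hV : V ∈ unitaryGroup (Bits N) ℂ) (f : ℝ → QState N)
    (t : ℝ) : deriv (fun t => act V (f t)) t = act V (deriv f t) := by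
  have h (W : Op N) {f : ℝ → QState N} {t : ℝ} (hf : DifferentiableAt ℝ f t) :
      HasDerivAt (fun t => act W (f t)) (act W (deriv f t)) t :=
    ((actCLM W).restrictScalars ℝ).hasFDerivAt.comp_hasDerivAt t hf.hasDerivAt
  by_cases hf : DifferentiableAt ℝ f t
  · exact (h V hf).deriv
  -- Where `f` is not differentiable, neither is `V f`, since `V` is inverted by its adjoint; both
  -- derivatives take the default value 0. Hence `qfim_act` needs no differentiability.
  · rw [deriv_zero_of_not_differentiableAt hf, deriv_zero_of_not_differentiableAt]
    · exact ((actCLM V).map_zero).symm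
    · intro hd
      refine hf ?_
      have := (h Vᴴ hd).differentiableAt
      simpa only [← act_mul, show Vᴴ * V = 1 from mem_unitaryGroup_iff'.1 hV, act_one] using this

theorem qfim_act {N : ℕ} {ι : Type*} [DecidableEq ι] {V : Op N}
    (hV : V ∈ unitaryGroup (Bits N) ℂ) (ψ : (ι → ℝ) → QState N) (θ : ι → ℝ) :
    qfim (fun θ' => act V (ψ θ')) θ = qfim ψ θ := by
  ext i j
  simp only [qfim, partialState, Matrix.of_apply, deriv_act hV, inner_act_act hV]

/-- Along one coordinate the state is `cos(t/2) u + sin(t/2) w`; differentiating gives a factor 1/2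
and advances the half-angle by `π/2`, that is, `t` by `π`. -/
theorem hasDerivAt_npqcState {N p : ℕ} (r : Equiv.Perm (Fin (N / 2))) (θ : Param N p → ℝ)
    (i : Param N p) (t : ℝ) :
    HasDerivAt (fun t => npqcState r (Function.update θ i t))
      ((1 / 2 : ℂ) • npqcState r (Function.update θ i (t + Real.pi))) t := by
  obtain ⟨L, R, α, n, h⟩ := exists_circuit_update_eq r θ i
  set u := act (L * R) (zeroState N)
  set w := act (L * ((-Complex.I) • onQubit n (pauli α)) * R) (zeroState N)
  have e (t : ℝ) : npqcState r (Function.update θ i t) =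
      Real.cos (t / 2) • u + Real.sin (t / 2) • w := by
    have h1 : rot α n t = (Real.cos (t / 2) : ℂ) • (1 : Op N) +
        (Real.sin (t / 2) : ℂ) • ((-Complex.I) • onQubit n (pauli α)) := by
      rw [rot_eq_onQubit, rotMat, onQubit_add, onQubit_smul, onQubit_smul, onQubit_one,
        smul_smul, mul_comm (-Complex.I)]
    rw [npqcState, h, h1, mul_add, add_mul, mul_smul_comm, mul_smul_comm, smul_mul_assoc,
      smul_mul_assoc, mul_one]
    simp only [u, w, act, add_mulVec, smul_mulVec, WithLp.toLp_add, WithLp.toLp_smul]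
    rfl
  have hc : HasDerivAt (fun t : ℝ => Real.cos (t / 2)) (-Real.sin (t / 2) * (1 / 2)) t :=
    ((hasDerivAt_id t).div_const 2).cos
  have hs : HasDerivAt (fun t : ℝ => Real.sin (t / 2)) (Real.cos (t / 2) * (1 / 2)) t :=
    ((hasDerivAt_id t).div_const 2).sin
  have hd := (hc.smul_const u).add (hs.smul_const w)
  have e' : (fun t => npqcState r (Function.update θ i t)) =
      fun t => Real.cos (t / 2) • u + Real.sin (t / 2) • w := funext e
  rw [e', e, show (t + Real.pi) / 2 = t / 2 + Real.pi / 2 by ring, Real.cos_add_pi_div_two,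
    Real.sin_add_pi_div_two]
  refine hd.congr_deriv ?_
  have half (v : QState N) : (1 / 2 : ℂ) • v = (1 / 2 : ℝ) • v := by
    rw [← Complex.coe_smul]; norm_num
  rw [half, smul_add, smul_smul, smul_smul, mul_comm (1 / 2 : ℝ), mul_comm (1 / 2 : ℝ)]

theorem partialState_npqcState {N p : ℕ} (r : Equiv.Perm (Fin (N / 2))) (θ : Param N p → ℝ)
    (i : Param N p) : partialState (npqcState r) θ i =
      (1 / 2 : ℂ) • npqcState r (Function.update θ i (θ i + Real.pi)) :=
  (hasDerivAt_npqcState r θ i (θ i)).deriv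

theorem differentiable_npqcState {N p : ℕ} (r : Equiv.Perm (Fin (N / 2))) :
    Differentiable ℝ (npqcState (N := N) (p := p) r) := by
  refine (differentiable_piLp 2).2 fun b => ?_
  simp only [npqcState, act, Matrix.mulVec, dotProduct]
  exact Differentiable.fun_sum fun c _ =>
    (circuit_mem_differentiableOps r b c).mul_const _

/-! ### The circuit with a reference unitary. -/

theorem npqcRefState_eq {N p : ℕ} (r : Equiv.Perm (Fin (N / 2))) (V : Op N) (θ : Param N p → ℝ) :
    npqcRefState r V θ = act (V * (circuit r (refParam N p))ᴴ) (npqcState r θ) := by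
  rw [npqcRefState, npqcState, act_mul]

theorem differentiable_npqcRefState {N p : ℕ} (r : Equiv.Perm (Fin (N / 2))) (V : Op N) :
    Differentiable ℝ (npqcRefState (N := N) (p := p) r V) := by
  rw [funext (npqcRefState_eq r V)]
  exact ((actCLM _).restrictScalars ℝ).differentiable.comp (differentiable_npqcState r)

theorem npqcRefState_refParam {N p : ℕ} (r : Equiv.Perm (Fin (N / 2))) (V : Op N) :
    npqcRefState r V (refParam N p) = act V (zeroState N) := by
  rw [npqcRefState, mul_assoc]
  have : (circuit r (refParam N p))ᴴ * circuit r (refParam N p) = 1 :=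
    mem_unitaryGroup_iff'.1 (circuit_mem_unitaryGroup r _)
  rw [this, mul_one]

/-- Extend `φ`, placed at the index of `|0⟩`, to an orthonormal basis and take its vectors as the
columns of `V`. -/
theorem exists_unitary_act_zeroState {N : ℕ} {φ : QState N} (hφ : ‖φ‖ = 1) :
    ∃ V ∈ unitaryGroup (Bits N) ℂ, act V (zeroState N) = φ := by
  have ho : Orthonormal ℂ (({fun _ => 0} : Set (Bits N)).domRestrict fun _ => φ) := by
    constructor
    · rintro ⟨x, hx⟩; exact hφ
    · rintro ⟨x, hx⟩ ⟨y, hy⟩ hxy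
      exact absurd (Subtype.ext (hx.trans hy.symm)) hxy
  obtain ⟨b, hb⟩ := ho.exists_orthonormalBasis_extension_of_card_eq (by simp)
  refine ⟨(EuclideanSpace.basisFun (Bits N) ℂ).toBasis.toMatrix b,
    OrthonormalBasis.toMatrix_orthonormalBasis_mem_unitary _ _, ?_⟩
  ext c
  have : b (fun _ => 0) = φ := hb _ rfl
  simp [act, zeroState, Module.Basis.toMatrix_apply, this]

/-! ### The QFIM at the reference parameter. -/

/-- The site at which a parameter acts. -/
def site {N p : ℕ} : Param N p → Fin N ⊕ ℕ × Fin (N / 2)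
  | Sum.inl (n, _) => Sum.inl n
  | Sum.inr (j, k, _) => Sum.inr (j.1, k)

/-- The axis of the rotation that a parameter controls. -/
def axis {N p : ℕ} : Param N p → Axis
  | Sum.inl (_, α) => α
  | Sum.inr (_, _, α) => α

theorem site_axis_injective {N p : ℕ} {i j : Param N p} (h : site i = site j)
    (h' : axis i = axis j) : i = j := by
  rcases i with ⟨n, α⟩ | ⟨l, k, α⟩ <;> rcases j with ⟨n', α'⟩ | ⟨l', k', α'⟩ <;>
    simp_all [site, axis, Fin.ext_iff]

theorem lt_of_site_eq {N p : ℕ} (i : Param N p) (j : ℕ) (k : Fin (N / 2))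
    (h : site i = Sum.inr (j, k)) : j < p - 1 := by
  rcases i with ⟨n, α⟩ | ⟨l, k', α⟩
  · simp [site] at h
  · simp only [site, Sum.inr.injEq, Prod.mk.injEq] at h
    exact h.1 ▸ l.2

/-- The phase of the state in which the angle of a rotation is increased by `π`. -/
def axisPhase : Axis → ℂ
  | Axis.y => 1
  | Axis.z => -Complex.I

theorem npqcState_refParam_mem_ray {N p : ℕ} (hN : Even N) (r : Equiv.Perm (Fin (N / 2))) :
    npqcState r (refParam N p) ∈ ray 1 (label (shiftFactor r) 0 (p - 1)) := by
  have h := npqcState_mem_ray hN r (θ := refParam N p) (d := 0) (g := fun _ => 1) (by simp)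
    (fun n => Or.inl ⟨rfl, rfl, rfl, rfl⟩) (fun j k => Or.inl ⟨rfl, rfl, rfl, rfl⟩)
  simpa using h

theorem npqcState_update_mem_ray {N p : ℕ} (hN : Even N) (r : Equiv.Perm (Fin (N / 2)))
    (i : Param N p) :
    npqcState r (Function.update (refParam N p) i (refParam N p i + Real.pi)) ∈
      ray (axisPhase (axis i)) (label (shiftFactor r) (Pi.single (site i) 2) (p - 1)) := by
  have h := npqcState_mem_ray hN r
    (θ := Function.update (refParam N p) i (refParam N p i + Real.pi))
    (d := Pi.single (site i) 2) (g := fun s => if s = site i then axisPhase (axis i) else 1)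
    ?_ ?_ ?_
  · convert h using 1
    rcases i with ⟨n, α⟩ | ⟨j, k, α⟩
    · simp [site]
    · simp only [site, reduceCtorEq, if_false, Finset.prod_const_one, one_mul, Sum.inr.injEq,
        Prod.mk.injEq]
      rw [Finset.prod_eq_single_of_mem j (Finset.mem_univ _), Finset.prod_eq_single_of_mem k
        (Finset.mem_univ _)]
      · simp
      · intro k' _ hk; simp [hk]
      · intro j' _ hj
        simp [Fin.val_inj, hj]
  · intro s
    rw [Pi.single_apply]
    split_ifs <;> decide
  · intro n
    rcases i with ⟨n', α⟩ | ⟨j, k, α⟩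
    · by_cases hn : n = n'
      · subst hn
        cases α
        · exact Or.inr (Or.inl (by simp [site, axis, axisPhase, refParam, refAngle]))
        · exact Or.inr (Or.inr (by simp [site, axis, axisPhase, refParam, refAngle]))
      · exact Or.inl (by simp [site, refParam, refAngle, hn])
    · exact Or.inl (by simp [site, refParam, refAngle])
  · intro j k
    rcases i with ⟨n', α⟩ | ⟨j', k', α⟩
    · exact Or.inl (by simp [site, refParam, refAngle])
    · by_cases hn : j = j' ∧ k = k'
      · obtain ⟨rfl, rfl⟩ := hn
        cases α
        · exact Or.inr (Or.inl (by simp [site, axis, axisPhase, refParam, refAngle]))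
        · exact Or.inr (Or.inr (by simp [site, axis, axisPhase, refParam, refAngle]))
      · have hn' : ¬ (j.1 = j'.1 ∧ k = k') := by rwa [Fin.val_inj]
        have h (α' : Axis) : (Sum.inr (j, k, α') : Param N p) ≠ Sum.inr (j', k', α) := by
          simp only [ne_eq, Sum.inr.injEq, Prod.mk.injEq]
          tauto
        refine Or.inl ⟨?_, ?_, ?_, ?_⟩
        · rw [Function.update_of_ne (h _)]; rfl
        · rw [Function.update_of_ne (h _)]; rfl
        · rw [Pi.single_eq_of_ne]
          simpa [site] using hn'
        · rw [if_neg]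
          simpa [site] using hn'

theorem inner_eq_of_mem_ray {N : ℕ} {q q' : Fin N → ZMod 4} (hq : ∀ n, 2 * q n = 2)
    (hq' : ∀ n, 2 * q' n = 2) {c c' : ℂ} {v w : QState N} (hv : v ∈ ray c q)
    (hw : w ∈ ray c' q') :
    inner ℂ v w = star c * c' * (if q = q' then 1 else 0) ∨
      inner ℂ v w = -(star c * c') * (if q = q' then 1 else 0) := by
  rcases hv with rfl | rfl <;> rcases hw with rfl | rfl <;>
    simp only [inner_smul_left, inner_smul_right, inner_stab hq hq', Complex.star_def, map_neg]
  · left; ring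
  · right; ring
  · right; ring
  · left; ring

theorem qfim_npqcState_refParam {N p : ℕ} (hN : Even N) (hp : p ≤ 2 ^ (N / 2))
    (r : Equiv.Perm (Fin (N / 2))) : qfim (npqcState r) (refParam N p) = 1 := by
  have hpos : 0 < 2 ^ (N / 2) := by positivity
  -- The bound on `p` enters here: the `p - 1` entanglers use only the shift factors that the picks
  -- define.
  have ha := hasIsolatedShifts_shiftFactor r (m := p - 1) (by omega)
  have hs (i : Param N p) (s) : 2 * (Pi.single (site i) 2 : Fin N ⊕ ℕ × Fin (N / 2) → ZMod 4) s
      = 0 := by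
    rw [Pi.single_apply]
    split_ifs <;> decide
  have hodd (i : Param N p) := two_mul_label (shiftFactor r) (hs i) (p - 1)
  have hodd0 := two_mul_label (N := N) (shiftFactor r) (d := 0) (by simp) (p - 1)
  ext i j
  -- Tangent vectors are orthogonal to the state itself, so the second term of the QFIM vanishes.
  have h0 : inner ℂ (npqcState r
      (Function.update (refParam N p) i (refParam N p i + Real.pi)))
      (npqcState r (refParam N p)) = 0 := by
    have hne : label (shiftFactor r) (Pi.single (site i) 2) (p - 1) ≠
        label (shiftFactor r) 0 (p - 1) := by
      rw [label_eq_add_labelDiff, Ne, add_eq_left]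
      exact labelDiff_single_ne_zero hN _ _ (lt_of_site_eq i)
    have := inner_eq_of_mem_ray (hodd i) hodd0 (npqcState_update_mem_ray hN r i)
      (npqcState_refParam_mem_ray hN r)
    simpa [hne] using this
  have h1 := inner_eq_of_mem_ray (hodd i) (hodd j) (npqcState_update_mem_ray hN r i)
    (npqcState_update_mem_ray hN r j)
  simp only [qfim, Matrix.of_apply, partialState_npqcState, inner_smul_left, inner_smul_right, h0]
  have hlab : label (shiftFactor r) (Pi.single (site i) 2) (p - 1) =
      label (shiftFactor r) (Pi.single (site j) 2) (p - 1) ↔ site i = site j := by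
    refine ⟨fun h => ?_, fun h => by rw [h]⟩
    rw [label_eq_add_labelDiff, label_eq_add_labelDiff _ (Pi.single (site j) 2), add_right_inj] at h
    exact labelDiff_single_injective hN ha (lt_of_site_eq i) (lt_of_site_eq j) h
  simp only [hlab] at h1
  by_cases hij : i = j
  · subst hij
    have hc : star (axisPhase (axis i)) * axisPhase (axis i) = 1 := by
      cases axis i <;> simp [axisPhase]
    rw [if_pos rfl, hc, mul_one] at h1
    rcases h1 with h1 | h1
    · rw [h1, Matrix.one_apply_eq]
      norm_num
    -- On the diagonal, positivity of the inner product excludes the sign left open by `ray`.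
    · have h2 := inner_self_nonneg (𝕜 := ℂ) (x := npqcState r
        (Function.update (refParam N p) i (refParam N p i + Real.pi)))
      rw [h1] at h2
      norm_num at h2
  · rw [Matrix.one_apply_ne hij]
    by_cases hsite : site i = site j
    -- The phases are 1 and `-i`, so the inner product is `±i` and has real part 0.
    · have hax : axis i ≠ axis j := fun h => hij (site_axis_injective hsite h)
      rw [if_pos hsite] at h1
      generalize axis i = α at *
      generalize axis j = β at *
      rcases h1 with h1 | h1 <;> rw [h1] <;> cases α <;> cases β <;>
        first | exact absurd rfl hax | simp [axisPhase]
    · rw [if_neg hsite, mul_zero, mul_zero, or_self] at h1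
      simp [h1]

theorem card_param (N p : ℕ) (hN : Even N) (hp : 1 ≤ p) :
    Fintype.card (Param N p) = N * (p + 1) := by
  have h : Fintype.card Axis = 2 := rfl
  obtain ⟨m, rfl⟩ := hN
  obtain ⟨q, rfl⟩ := Nat.exists_eq_add_of_le hp
  simp only [Fintype.card_sum, Fintype.card_prod, Fintype.card_fin, h,
    show (m + m) / 2 = m by omega, Nat.add_sub_cancel_left]
  ring

end NPQC

end

theorem mainTheorem2 (N p : ℕ) (hN : Even N) (hp : 1 ≤ p) (hp' : p ≤ 2 ^ (N / 2))
    (r : Equiv.Perm (Fin (N / 2))) :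
    -- the number of parameters
    Fintype.card (NPQC.Param N p) = N * (p + 1) ∧
    -- the circuit is unitary and depends differentiably on the parameters
    (∀ θ : NPQC.Param N p → ℝ,
      NPQC.circuit r θ ∈ Matrix.unitaryGroup (NPQC.Bits N) ℂ) ∧
    Differentiable ℝ (NPQC.npqcState (N := N) (p := p) r) ∧
    -- the QFIM at the reference parameter is the identity
    NPQC.qfim (NPQC.npqcState r) (NPQC.refParam N p) = 1 ∧
    -- the QFIM of any family of states is invariant under a further unitary
    (∀ (M : ℕ) (ψ : (Fin M → ℝ) → NPQC.QState N),
      ∀ V ∈ Matrix.unitaryGroup (NPQC.Bits N) ℂ, ∀ θ : Fin M → ℝ,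
        NPQC.qfim (fun θ' => NPQC.act V (ψ θ')) θ = NPQC.qfim ψ θ) ∧
    -- the same for the NPQC with a reference unitary, whose reference state is `V|0⟩`
    (∀ V ∈ Matrix.unitaryGroup (NPQC.Bits N) ℂ,
      NPQC.npqcRefState r V (NPQC.refParam N p) = NPQC.act V (NPQC.zeroState N) ∧
      Differentiable ℝ (NPQC.npqcRefState (N := N) (p := p) r V) ∧
      NPQC.qfim (NPQC.npqcRefState r V) (NPQC.refParam N p) = 1) ∧
    -- every pure state is the reference state of some reference unitary
    (∀ φ : NPQC.QState N, ‖φ‖ = 1 →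
      ∃ V ∈ Matrix.unitaryGroup (NPQC.Bits N) ℂ,
        NPQC.npqcRefState r V (NPQC.refParam N p) = φ) := by
  refine ⟨NPQC.card_param N p hN hp, NPQC.circuit_mem_unitaryGroup r,
    NPQC.differentiable_npqcState r, NPQC.qfim_npqcState_refParam hN hp' r,
    fun M ψ V hV θ => NPQC.qfim_act hV ψ θ, fun V hV => ⟨NPQC.npqcRefState_refParam r V,
      NPQC.differentiable_npqcRefState r V, ?_⟩, fun φ hφ => ?_⟩
  · have hU : (NPQC.circuit r (NPQC.refParam N p)).conjTranspose ∈
        Matrix.unitaryGroup (NPQC.Bits N) ℂ :=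
      Unitary.star_mem (NPQC.circuit_mem_unitaryGroup r _)
    rw [funext (NPQC.npqcRefState_eq r V), NPQC.qfim_act (mul_mem hV hU),
      NPQC.qfim_npqcState_refParam hN hp' r]
  · obtain ⟨V, hV, h⟩ := NPQC.exists_unitary_act_zeroState hφ
    exact ⟨V, hV, (NPQC.npqcRefState_refParam r V).trans h⟩
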